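/- There is an algorithm, and there is an absolute constant $C>0$, such that the following holds for all integers $n\ge 1$ and all $\epsilon\in(0,1]$. Let $P$ and $Q$ be product distributions over $\{0,1\}^n$, where $Q$ is known exactly (the algorithm is given $n$, $\epsilon$ and the parameters $q_i=\Pr_{Y\sim Q}[Y_i=1]$) and $P$ is accessible only through independent samples. Then the algorithm always stops after drawing at most $C\sqrt n/\epsilon^2$ samples and within time $C n^{1.5}/\epsilon^2$, and it distinguishes $P=Q$ from $\delta(P,Q)\ge\epsilon$ with error probability at most $\frac13$: if $P=Q$ it answers "$P=Q$" with probability at least $\frac23$, and if $\delta(P,Q)\ge\epsilon$ it answers "$\delta(P,Q)\ge\epsilon$" with probability at least $\frac23$. Here $\delta(P,Q)=\frac12\sum_{x\in\{0,1\}^n}|P(x)-Q(x)|$ is the total variation distance. Algorithms are programs for a real RAM (exact real arithmetic and comparisons at unit cost, rational constants, no rounding, indirect addressing) that can flip fair coins, draw samples and read the coordinates of the current sample one at a time; time is the number of executed instructions. The sample complexity is optimal up to constant factors: for every $\epsilon_0<1$ there is a constant $c>0$ such that for all $n\ge 1$ and $0<\epsilon\le\epsilon_0$ there is a product distribution $Q$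 over $\{0,1\}^n$ such that every randomized test on $m$ samples, regardless of its running time, that distinguishes $P=Q$ from $\delta(P,Q)\ge\epsilon$ with error probability at most $\frac13$ for every product distribution $P$ over $\{0,1\}^n$ uses $m\ge c\sqrt n/\epsilon^2$ samples. -/

import Mathlib

open MeasureTheory

noncomputable section

namespace ProductTesting

/-! ### Distributions on the hypercube -/

/-- The hypercube `{0,1}^n`, with `true` for `1`. -/
abbrev Cube (n : ℕ) : Type := Fin n → Bool

/-- `P` is a product distribution: the coordinates are mutually independent bits. -/
def IsProductDistribution {n : ℕ} (P : Measure (Cube n)) : Prop :=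
  ∃ μ : Fin n → Measure Bool, (∀ i, IsProbabilityMeasure (μ i)) ∧ P = Measure.pi μ

/-- The expectation of the `i`-th coordinate, that is, the probability that it equals `1`. -/
def coordMean {n : ℕ} (Q : Measure (Cube n)) (i : Fin n) : ℝ :=
  Q.real {x | x i = true}

/-- Total variation distance, half of the `ℓ₁` distance of the mass functions. -/
def tvDist {n : ℕ} (P Q : Measure (Cube n)) : ℝ :=
  (1 / 2) * ∑ x : Cube n, |P.real {x} - Q.real {x}|

/-! ### Machine model: a real RAM with sample access and coin flips

There are index registers `I_0, I_1, …` holding natural numbers, real registers `R_0, R_1, …`,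
and a real memory `M` that is addressed through the index registers.  Arithmetic operations and
comparisons of reals are exact and have unit cost.  No rounding, and no conversion of reals to
natural numbers, is available, and the only constants in a program are natural and rational
numbers. -/

/-- The instructions.  A jump goes to the given line of the program when its condition holds. -/
inductive Instr where
  /-- `I_i := k` -/
  | iconst (i k : ℕ)
  /-- `I_i := I_j + I_k` -/
  | iadd (i j k : ℕ)
  /-- `I_i := max (I_j - I_k) 0` -/
  | isub (i j k : ℕ)
  /-- if `I_i < I_j`, go to `line` -/
  | jumpILt (i j line : ℕ)
  /-- `R_r := c` -/
  | rconst (r : ℕ) (c : ℚ)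
  /-- `R_r := R_s + R_t` -/
  | radd (r s t : ℕ)
  /-- `R_r := R_s - R_t` -/
  | rsub (r s t : ℕ)
  /-- `R_r := R_s * R_t` -/
  | rmul (r s t : ℕ)
  /-- `R_r := R_s / R_t`, with value `0` when `R_t = 0` -/
  | rdiv (r s t : ℕ)
  /-- if `R_r ≤ R_s`, go to `line` -/
  | jumpRLe (r s line : ℕ)
  /-- `R_r := M[I_i]` -/
  | load (r i : ℕ)
  /-- `M[I_i] := R_r` -/
  | store (i r : ℕ)
  /-- draw a fresh sample, which becomes the current sample -/
  | draw
  /-- `R_r :=` the coordinate with number `I_i` of the current sample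
  (`0` if there is no such coordinate or no sample yet) -/
  | bit (r i : ℕ)
  /-- `R_r :=` the outcome (`0` or `1`) of a fresh fair coin flip -/
  | coin (r : ℕ)
  /-- stop, with answer `b` -/
  | halt (b : Bool)

/-- A program is a finite list of instructions. -/
abbrev Program : Type := List Instr

/-- A configuration of the machine. -/
structure Config where
  /-- number of the line to be executed next -/
  line : ℕ
  /-- index registers -/
  idx : ℕ → ℕ
  /-- real registers -/
  reg : ℕ → ℝ
  /-- memory -/
  mem : ℕ → ℝ
  /-- number of samples drawn so far -/
  drawn : ℕ
  /-- number of coins flipped so far -/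
  flipped : ℕ
  /-- the answer, once the machine has stopped -/
  answer : Option Bool

/-- A source of randomness: the sequence of samples and the sequence of coin flips. -/
abbrev Source (n : ℕ) : Type := (ℕ → Cube n) × (ℕ → Bool)

/-- A bit as a real number. -/
def bitVal (b : Bool) : ℝ := if b then 1 else 0

/-- The coordinate with number `k` of the last one of the first `d` samples. -/
def sampleBit {n : ℕ} (ω : Source n) (d k : ℕ) : ℝ :=
  if h : 0 < d ∧ k < n then bitVal (ω.1 (d - 1) ⟨k, h.2⟩) else 0

/-- The effect of a single instruction. -/
def exec {n : ℕ} (ω : Source n) (c : Config) : Instr → Config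
  | .iconst i k => { c with line := c.line + 1, idx := Function.update c.idx i k }
  | .iadd i j k =>
      { c with line := c.line + 1, idx := Function.update c.idx i (c.idx j + c.idx k) }
  | .isub i j k =>
      { c with line := c.line + 1, idx := Function.update c.idx i (c.idx j - c.idx k) }
  | .jumpILt i j l => { c with line := if c.idx i < c.idx j then l else c.line + 1 }
  | .rconst r q => { c with line := c.line + 1, reg := Function.update c.reg r (q : ℝ) }
  | .radd r s t =>
      { c with line := c.line + 1, reg := Function.update c.reg r (c.reg s + c.reg t) }
  | .rsub r s t =>
      { c with line := c.line + 1, reg := Function.update c.reg r (c.reg s - c.reg t) }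
  | .rmul r s t =>
      { c with line := c.line + 1, reg := Function.update c.reg r (c.reg s * c.reg t) }
  | .rdiv r s t =>
      { c with line := c.line + 1, reg := Function.update c.reg r (c.reg s / c.reg t) }
  | .jumpRLe r s l =>
      open Classical in { c with line := if c.reg r ≤ c.reg s then l else c.line + 1 }
  | .load r i =>
      { c with line := c.line + 1, reg := Function.update c.reg r (c.mem (c.idx i)) }
  | .store i r =>
      { c with line := c.line + 1, mem := Function.update c.mem (c.idx i) (c.reg r) }
  | .draw => { c with line := c.line + 1, drawn := c.drawn + 1 }
  | .bit r i =>
      { c with line := c.line + 1,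
               reg := Function.update c.reg r (sampleBit ω c.drawn (c.idx i)) }
  | .coin r =>
      { c with line := c.line + 1, flipped := c.flipped + 1,
               reg := Function.update c.reg r (bitVal (ω.2 c.flipped)) }
  | .halt b => { c with answer := some b }

/-- One step of computation.  A machine that has answered stays as it is; a machine that has left
its program without an answer is stuck and never gives one. -/
def step {n : ℕ} (prog : Program) (ω : Source n) (c : Config) : Config :=
  match c.answer, prog[c.line]? with
  | none, some instr => exec ω c instr
  | _, _ => c

/-- The initial configuration: the inputs are `n` in `I_0`, `ε` in `R_0`, and the parameters
`q_0, …, q_{n-1}` of the known distribution in the first `n` memory cells; all else is `0`. -/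
def start {n : ℕ} (ε : ℝ) (q : Fin n → ℝ) : Config where
  line := 0
  idx := Function.update (fun _ => 0) 0 n
  reg := Function.update (fun _ => 0) 0 ε
  mem := fun k => if h : k < n then q ⟨k, h⟩ else 0
  drawn := 0
  flipped := 0
  answer := none

/-- The configuration after `t` steps. -/
def run {n : ℕ} (prog : Program) (ε : ℝ) (q : Fin n → ℝ) (ω : Source n) (t : ℕ) : Config :=
  (step prog ω)^[t] (start ε q)

/-- The law of the source of randomness: independent samples from `P`, and independent fair coin
flips that are independent of the samples. -/
def sourceLaw {n : ℕ} (P : Measure (Cube n)) [IsProbabilityMeasure P] : Measure (Source n) :=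
  (Measure.infinitePi fun _ : ℕ => P).prod
    (Measure.infinitePi fun _ : ℕ => (PMF.uniformOfFintype Bool).toMeasure)

/-- On inputs `n`, `ε` and the parameters of `Q`, the program always answers within `T` steps,
having drawn at most `m` samples, and for every product distribution `P` from which the samples
come, its error probability is at most `1/3`: the answer is `true` if `P = Q`, and `false` if `P`
is at distance at least `ε` from `Q`. -/
def Distinguishes {n : ℕ} (prog : Program) (ε : ℝ) (Q : Measure (Cube n)) (m T : ℕ) : Prop :=
  (∀ ω : Source n, (run prog ε (coordMean Q) ω T).answer ≠ none ∧
    (run prog ε (coordMean Q) ω T).drawn ≤ m) ∧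
  ∀ (P : Measure (Cube n)) [IsProbabilityMeasure P], IsProductDistribution P →
    (P = Q →
      (sourceLaw P).real {ω | (run prog ε (coordMean Q) ω T).answer ≠ some true} ≤ 1 / 3) ∧
    (ε ≤ tvDist P Q →
      (sourceLaw P).real {ω | (run prog ε (coordMean Q) ω T).answer ≠ some false} ≤ 1 / 3)

/-! ### Testers without computational constraints -/

/-- A randomized test on `m` samples, given by its probability `φ x` of answering `P = Q` when the
samples are `x`, has error probability at most `1/3` in distinguishing `P = Q` from `P` at distance
at least `ε` from `Q`, among product distributions `P`. -/
def IsTester {n m : ℕ} (ε : ℝ) (Q : Measure (Cube n)) (φ : (Fin m → Cube n) → unitInterval) :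
    Prop :=
  ∀ (P : Measure (Cube n)) [IsProbabilityMeasure P], IsProductDistribution P →
    (P = Q → ∫ x, (1 - (φ x : ℝ)) ∂(Measure.pi fun _ : Fin m => P) ≤ 1 / 3) ∧
    (ε ≤ tvDist P Q → ∫ x, (φ x : ℝ) ∂(Measure.pi fun _ : Fin m => P) ≤ 1 / 3)

end ProductTesting

end

open ProductTesting

/-! Upper bound. Let `δ_i = p_i - q_i`, and let `Y_ij` be the `j`-th sample of bit `i` minus `q_i`.
The statistic is `T = ∑ i, w_i * ∑_{j<k} Y_ij * Y_ik` with weights `w_i = 1 / (q_i (1 - q_i) + ε² /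
(4n))`; the extra term keeps the weights bounded when `q_i` is near 0 or 1. Its mean is `m(m-1)/2 *
S` with `S = ∑ i, w_i δ_i²`, so it vanishes when `P = Q`. Since the Bhattacharyya coefficient is
multiplicative over products, `δ(P,Q)² ≤ 2S + ε²/4` (`sq_tvDist_le`), hence `S ≥ 3ε²/8` when `P` is
far. The exact variance (`variance_statistic`) and its estimate (`variance_bound`) let Chebyshev's
inequality separate the two cases at the threshold `m²ε²/32` once `m ε² ≥ 1024 √n`. Keeping one
running sum per coordinate makes `T` computable online in `O(n)` steps per sample; loop invariants
verify this (`run_uStatTester`).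

Lower bound. Let `Q` be uniform and let `P` have bias `±η` in each coordinate, with random signs.
The second moment of the likelihood ratio of `m` samples from this mixture is at most `exp(n (m η²)²
/ 2)`, so a tester forces `n (m η²)² ≥ 1/5` (`le_of_isTester_uniform`). For small `ε`, `η` of order
`ε / √n` suffices for distance `ε` (`biased_tvDist_ge`). For `ε` bounded below, `η²` of order `1/n`
suffices if `n` is large (`biased_affinity`); for bounded `n` it is enough that one sample is
needed. -/

namespace ProductTesting

/-! ### The program and its loop invariants -/

/-- A tester for product distributions.  It draws samples until their number `m` satisfies
`2 ^ 20 * n ≤ (m * ε ^ 2) ^ 2`, and on the way accumulates a weighted `U`-statistic. -/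
def uStatTester : Program :=
  -- No instruction turns the index `n` into a real, so `2 ^ 20 * n` is built by `n` additions.
  [.iconst 2 1, .rconst 1 1048576, .radd 2 2 1, .iadd 1 1 2, .jumpILt 1 0 2,
   -- `R_4` becomes `2 ^ 18 * ε² / (2 ^ 20 * n) = ε² / (4n)`.
   .rmul 3 0 0, .rconst 4 262144, .rmul 4 4 3, .rdiv 4 4 2, .rconst 1 1,
   .draw, .iconst 1 0,
   .bit 6 1, .load 7 1, .rsub 6 6 7, .rsub 8 1 7, .rmul 7 7 8, .radd 7 7 4,
   .iadd 3 0 1, .load 8 3, .rmul 9 6 8, .rdiv 9 9 7, .radd 10 10 9, .radd 8 8 6, .store 3 8,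
   .iadd 1 1 2, .jumpILt 1 0 12,
   -- The stopping rule compares squares because the machine has no square root. The test `R_0 ≤
   -- R_0` is an unconditional jump.
   .radd 5 5 3, .rmul 11 5 5, .jumpRLe 2 11 31, .jumpRLe 0 0 10,
   .rmul 10 10 3, .rconst 12 (1 / 32), .rmul 11 11 12, .jumpRLe 11 10 36, .halt true, .halt false]

/-- The sum of the first `r` terms of a sequence of centered observations. -/
noncomputable def partialSum (y : ℕ → ℝ) (r : ℕ) : ℝ := ∑ j ∈ Finset.range r, y j

/-- The sum of the products of pairs among the first `r` observations. -/
noncomputable def pairSum (y : ℕ → ℝ) (r : ℕ) : ℝ := ∑ j ∈ Finset.range r, y j * partialSum y j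

section Machine

variable {n : ℕ} (ε : ℝ) (q : Fin n → ℝ) (ω : Source n)

/-- The initial content of the memory. -/
noncomputable def param (k : ℕ) : ℝ := if h : k < n then q ⟨k, h⟩ else 0

/-- The centered `j`-th observation of coordinate `i`. -/
noncomputable def observation (i j : ℕ) : ℝ := sampleBit ω (j + 1) i - param q i

/-- The regularized variance of coordinate `i`. -/
noncomputable def regVar (i : ℕ) : ℝ :=
  param q i * (1 - param q i) + ε ^ 2 / (4 * n)

/-- The test statistic after `r` samples. -/
noncomputable def statistic (r : ℕ) : ℝ :=
  ∑ i ∈ Finset.range n, pairSum (observation q ω i) r / regVar ε q i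

/-- The state of the machine, at line `L`, when the first `i` coordinates of sample number `r`
have been processed. -/
structure CoordInv (L r i : ℕ) (c : Config) : Prop where
  line : c.line = L
  answer : c.answer = none
  drawn : c.drawn = r + 1
  idx0 : c.idx 0 = n
  idx1 : c.idx 1 = i
  idx2 : c.idx 2 = 1
  reg1 : c.reg 1 = 1
  reg2 : c.reg 2 = 1048576 * n
  reg3 : c.reg 3 = ε ^ 2
  reg4 : c.reg 4 = ε ^ 2 / (4 * n)
  reg5 : c.reg 5 = r * ε ^ 2
  reg10 : c.reg 10 = statistic ε q ω r +
    ∑ k ∈ Finset.range i,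
      observation q ω k r * partialSum (observation q ω k) r / regVar ε q k
  memParam : ∀ k < n, c.mem k = param q k
  memSum : ∀ k < n, c.mem (n + k) =
    if k < i then partialSum (observation q ω k) (r + 1) else partialSum (observation q ω k) r

/-- The state of the machine, at line `L`, when `r` samples have been processed. -/
structure SampleInv (L r : ℕ) (c : Config) : Prop where
  line : c.line = L
  answer : c.answer = none
  drawn : c.drawn = r
  idx0 : c.idx 0 = n
  idx2 : c.idx 2 = 1
  reg1 : c.reg 1 = 1
  reg2 : c.reg 2 = 1048576 * n
  reg3 : c.reg 3 = ε ^ 2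
  reg4 : c.reg 4 = ε ^ 2 / (4 * n)
  reg5 : c.reg 5 = r * ε ^ 2
  reg10 : c.reg 10 = statistic ε q ω r
  memParam : ∀ k < n, c.mem k = param q k
  memSum : ∀ k < n, c.mem (n + k) = partialSum (observation q ω k) r

variable {ε q ω}

theorem CoordInv.next {r i : ℕ} {c : Config} (h : CoordInv ε q ω 12 r i c) (hi : i < n) :
    CoordInv ε q ω (if i + 1 < n then 12 else 27) r (i + 1) ((step uStatTester ω)^[15] c) := by
  obtain ⟨L, I, R, M, d, f, a⟩ := c
  obtain ⟨h1, h2, h3, h4, h5, h6, h7, h8, h9, h10, h11, h12, h13, h14⟩ := h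
  dsimp only at h1 h2 h3 h4 h5 h6 h7 h8 h9 h10 h11 h12 h13 h14
  subst h1 h2 h3
  have hM := h14 i hi
  simp only [lt_irrefl, if_false] at hM
  have hq := h13 i hi
  constructor <;>
    simp [Function.iterate_succ_apply, step, exec, uStatTester, Function.update_apply, h4, h5, h6,
      h7, h8, h9, h10, h11, h12, hM, hq]
  · rw [Finset.sum_range_succ, ← add_assoc]
    rfl
  · intro k hk
    rw [if_neg (by omega), h13 k hk]
  · intro k hk
    rcases lt_trichotomy k i with hki | rfl | hki
    · rw [if_neg (by omega), h14 k hk, if_pos hki, if_pos (by omega)]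
    · simp [partialSum, Finset.sum_range_succ, observation]
      ring
    · rw [if_neg (by omega), h14 k hk, if_neg (by omega), if_neg (by omega)]

/-- Induction on the number `j + 1` of coordinates left, so that the last pass, which exits the
loop, is the base case. -/
theorem CoordInv.finish {r : ℕ} (j : ℕ) {i : ℕ} {c : Config} (h : CoordInv ε q ω 12 r i c)
    (hj : i + (j + 1) = n) :
    CoordInv ε q ω 27 r n ((step uStatTester ω)^[15 * (j + 1)] c) := by
  induction j generalizing i c with
  | zero =>
    have := h.next (by omega)
    rw [if_neg (by omega)] at this
    have hi : i + 1 = n := by omega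
    rw [hi] at this
    exact this
  | succ j ih =>
    have := h.next (by omega)
    rw [if_pos (by omega)] at this
    have := ih this (by omega)
    rwa [← Function.iterate_add_apply, ← mul_add_one] at this

theorem SampleInv.next {r : ℕ} {c : Config} (h : SampleInv ε q ω 10 r c) :
    CoordInv ε q ω 12 r 0 ((step uStatTester ω)^[2] c) := by
  obtain ⟨L, I, R, M, d, f, a⟩ := c
  obtain ⟨h1, h2, h3, h4, h6, h7, h8, h9, h10, h11, h12, h13, h14⟩ := h
  dsimp only at h1 h2 h3 h4 h6 h7 h8 h9 h10 h11 h12 h13 h14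
  subst h1 h2 h3
  constructor <;>
    simp [Function.iterate_succ_apply, step, exec, uStatTester, h4, h6,
      h7, h8, h9, h10, h11, h12]
  · exact h13
  · exact h14

theorem CoordInv.toSampleInv {r : ℕ} {c : Config} (h : CoordInv ε q ω 27 r n c)
    (hr : ((r + 1 : ℕ) * ε ^ 2) ^ 2 < 1048576 * n) :
    SampleInv ε q ω 10 (r + 1) ((step uStatTester ω)^[4] c) := by
  obtain ⟨L, I, R, M, d, f, a⟩ := c
  obtain ⟨h1, h2, h3, h4, h5, h6, h7, h8, h9, h10, h11, h12, h13, h14⟩ := h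
  dsimp only at h1 h2 h3 h4 h5 h6 h7 h8 h9 h10 h11 h12 h13 h14
  subst h1 h2 h3
  have hr' : ¬ (1048576 * (n : ℝ) ≤ (r * ε ^ 2 + ε ^ 2) * (r * ε ^ 2 + ε ^ 2)) := by
    push_cast at hr
    rw [not_le]
    linarith
  constructor <;>
    simp [Function.iterate_succ_apply, step, exec, uStatTester, h4, h6,
      h7, h8, h9, h10, h11, h12, hr']
  · ring
  · rw [statistic, statistic, ← Finset.sum_add_distrib]
    refine Finset.sum_congr rfl fun k _ => ?_
    rw [pairSum, pairSum, Finset.sum_range_succ, add_div]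
  · exact h13
  · intro k hk
    rw [h14 k hk, if_pos hk]

open Classical in
theorem CoordInv.halt {r : ℕ} {c : Config} (h : CoordInv ε q ω 27 r n c)
    (hr : 1048576 * n ≤ ((r + 1 : ℕ) * ε ^ 2) ^ 2) :
    ((step uStatTester ω)^[8] c).drawn = r + 1 ∧
    ((step uStatTester ω)^[8] c).answer = some (decide
      (statistic ε q ω (r + 1) * ε ^ 2 < ((r + 1 : ℕ) * ε ^ 2) ^ 2 / 32)) := by
  obtain ⟨L, I, R, M, d, f, a⟩ := c
  obtain ⟨h1, h2, h3, h4, h5, h6, h7, h8, h9, h10, h11, h12, h13, h14⟩ := h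
  dsimp only at h1 h2 h3 h4 h5 h6 h7 h8 h9 h10 h11 h12 h13 h14
  subst h1 h2 h3
  have hr' : 1048576 * (n : ℝ) ≤ (r * ε ^ 2 + ε ^ 2) * (r * ε ^ 2 + ε ^ 2) := by
    push_cast at hr
    linarith
  have hs : statistic ε q ω (r + 1) = R 10 := by
    rw [h12, statistic, statistic, ← Finset.sum_add_distrib]
    refine Finset.sum_congr rfl fun k _ => ?_
    rw [pairSum, pairSum, Finset.sum_range_succ, add_div]
  have he : ((r + 1 : ℕ) * ε ^ 2) ^ 2 / 32 =
      (r * ε ^ 2 + ε ^ 2) * (r * ε ^ 2 + ε ^ 2) * 32⁻¹ := by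
    push_cast
    ring
  rw [hs, he]
  by_cases hlt : (r * ε ^ 2 + ε ^ 2) * (r * ε ^ 2 + ε ^ 2) * 32⁻¹ ≤ R 10 * ε ^ 2
  · have := not_lt.2 hlt
    constructor <;>
    simp [Function.iterate_succ_apply, step, exec, uStatTester,
      h8, h9, h11, hr', hlt]
  · have := not_le.1 hlt
    constructor <;>
    simp [Function.iterate_succ_apply, step, exec, uStatTester,
      h8, h9, h11, hr', hlt, this]

/-- The state of the machine during the loop that determines the number of coordinates. -/
structure CountInv (ε : ℝ) (q : Fin n → ℝ) (L i : ℕ) (c : Config) : Prop where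
  line : c.line = L
  answer : c.answer = none
  drawn : c.drawn = 0
  idx0 : c.idx 0 = n
  idx1 : c.idx 1 = i
  idx2 : c.idx 2 = 1
  reg0 : c.reg 0 = ε
  reg1 : c.reg 1 = 1048576
  reg2 : c.reg 2 = 1048576 * i
  reg5 : c.reg 5 = 0
  reg10 : c.reg 10 = 0
  mem : c.mem = param q

variable (ε q ω) in
theorem countInv_start :
    CountInv ε q 2 0 ((step uStatTester ω)^[2] (start ε q)) := by
  constructor <;>
    simp [Function.iterate_succ_apply, step, exec, uStatTester, start]
  rfl

theorem CountInv.next {i : ℕ} {c : Config} (h : CountInv ε q 2 i c) :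
    CountInv ε q (if i + 1 < n then 2 else 5) (i + 1) ((step uStatTester ω)^[3] c) := by
  obtain ⟨L, I, R, M, d, f, a⟩ := c
  obtain ⟨h1, h2, h3, h4, h5, h6, h7, h8, h9, h10, h11, h12⟩ := h
  dsimp only at h1 h2 h3 h4 h5 h6 h7 h8 h9 h10 h11 h12
  subst h1 h2 h3
  constructor <;>
    simp [Function.iterate_succ_apply, step, exec, uStatTester, h4, h5, h6,
      h7, h8, h9, h10, h11, h12]
  ring

theorem CountInv.finish (j : ℕ) {i : ℕ} {c : Config} (h : CountInv ε q 2 i c)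
    (hj : i + (j + 1) = n) :
    CountInv ε q 5 n ((step uStatTester ω)^[3 * (j + 1)] c) := by
  induction j generalizing i c with
  | zero =>
    have := h.next (ω := ω)
    rw [if_neg (by omega)] at this
    have hi : i + 1 = n := by omega
    rw [hi] at this
    exact this
  | succ j ih =>
    have := h.next (ω := ω)
    rw [if_pos (by omega)] at this
    have := ih this (by omega)
    rwa [← Function.iterate_add_apply, ← mul_add_one] at this

theorem CountInv.toSampleInv {c : Config} (h : CountInv ε q 5 n c) (hn : 1 ≤ n) :
    SampleInv ε q ω 10 0 ((step uStatTester ω)^[5] c) := by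
  obtain ⟨L, I, R, M, d, f, a⟩ := c
  obtain ⟨h1, h2, h3, h4, h5, h6, h7, h8, h9, h10, h11, h12⟩ := h
  dsimp only at h1 h2 h3 h4 h5 h6 h7 h8 h9 h10 h11 h12
  subst h1 h2 h3
  have hn' : (n : ℝ) ≠ 0 := by exact_mod_cast (by omega : n ≠ 0)
  constructor <;>
    simp [Function.iterate_succ_apply, step, exec, uStatTester, h4, h6,
      h7, h9, h10, h11, h12]
  · ring
  · field_simp
    ring
  · simp [statistic, pairSum]
  · intro k hk
    simp [partialSum, param]

/-- One sample costs `2 + 15 * n + 4` steps: setup, coordinate loop, stopping test. The bounds on `k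
≤ r` say that this test keeps failing. -/
theorem SampleInv.iterate {r : ℕ} {c : Config} (h : SampleInv ε q ω 10 0 c) (hn : 1 ≤ n)
    (hr : ∀ k ≤ r, ((k : ℕ) * ε ^ 2) ^ 2 < 1048576 * n) :
    SampleInv ε q ω 10 r ((step uStatTester ω)^[(6 + 15 * n) * r] c) := by
  induction r with
  | zero => exact h
  | succ r ih =>
    have h1 := (ih fun k hk => hr k (by omega)).next.finish (n - 1) (by omega)
    have h2 := h1.toSampleInv (hr (r + 1) le_rfl)
    rw [← Function.iterate_add_apply, ← Function.iterate_add_apply,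
      ← Function.iterate_add_apply] at h2
    convert h2 using 2
    rw [Nat.sub_add_cancel hn]
    ring

variable (ε q ω) in
open Classical in
/-- The outcome of a run of the tester. -/
theorem run_uStatTester {r : ℕ} (hn : 1 ≤ n)
    (hr : ∀ k ≤ r, ((k : ℕ) * ε ^ 2) ^ 2 < 1048576 * n)
    (hr' : 1048576 * n ≤ ((r + 1 : ℕ) * ε ^ 2) ^ 2) :
    (run uStatTester ε q ω (17 + 18 * n + (6 + 15 * n) * r)).drawn = r + 1 ∧
    (run uStatTester ε q ω (17 + 18 * n + (6 + 15 * n) * r)).answer = some (decide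
      (statistic ε q ω (r + 1) * ε ^ 2 < ((r + 1 : ℕ) * ε ^ 2) ^ 2 / 32)) := by
  have h0 := ((countInv_start ε q ω).finish (ω := ω) (n - 1) (by omega)).toSampleInv (ω := ω) hn
  have h1 := (((h0.iterate hn hr).next).finish (n - 1) (by omega)).halt hr'
  simp only [← Function.iterate_add_apply] at h1
  have ht : 8 + (15 * (n - 1 + 1) + (2 + ((6 + 15 * n) * r + (5 + (3 * (n - 1 + 1) + 2))))) =
      17 + 18 * n + (6 + 15 * n) * r := by
    rw [Nat.sub_add_cancel hn]
    ring
  rw [ht] at h1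
  exact h1

end Machine

/-! ### Moments of the U-statistic -/

section Moments

open ProbabilityTheory

/-- Bounded measurable real functions. -/
def BddMeas {Ω : Type*} [MeasurableSpace Ω] (f : Ω → ℝ) : Prop :=
  Measurable f ∧ ∃ C : ℝ, ∀ ω, |f ω| ≤ C

variable {Ω : Type*} [MeasurableSpace Ω] {μ : Measure Ω} {f g : Ω → ℝ}

theorem BddMeas.add (hf : BddMeas f) (hg : BddMeas g) : BddMeas fun ω => f ω + g ω := by
  obtain ⟨hf, C, hC⟩ := hf
  obtain ⟨hg, D, hD⟩ := hg
  exact ⟨hf.add hg, C + D, fun ω => (abs_add_le _ _).trans (add_le_add (hC ω) (hD ω))⟩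

theorem BddMeas.mul (hf : BddMeas f) (hg : BddMeas g) : BddMeas fun ω => f ω * g ω := by
  obtain ⟨hf, C, hC⟩ := hf
  obtain ⟨hg, D, hD⟩ := hg
  refine ⟨hf.mul hg, C * D, fun ω => ?_⟩
  rw [abs_mul]
  exact mul_le_mul (hC ω) (hD ω) (abs_nonneg _) ((abs_nonneg _).trans (hC ω))

theorem bddMeas_const (c : ℝ) : BddMeas fun _ : Ω => c :=
  ⟨measurable_const, |c|, fun _ => le_rfl⟩

theorem BddMeas.const_mul (c : ℝ) (hf : BddMeas f) : BddMeas fun ω => c * f ω :=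
  (bddMeas_const c).mul hf

theorem BddMeas.sum {ι : Type*} (s : Finset ι) {F : ι → Ω → ℝ} (hF : ∀ i ∈ s, BddMeas (F i)) :
    BddMeas fun ω => ∑ i ∈ s, F i ω := by
  classical
  induction s using Finset.induction_on with
  | empty => simpa using bddMeas_const 0
  | insert a s ha ih =>
    simp only [Finset.sum_insert ha]
    exact (hF a (by simp)).add (ih fun i hi => hF i (by simp [hi]))

/-- Together with the closure properties above, this disposes of every integrability condition in
the moment computations. -/
theorem BddMeas.integrable [IsProbabilityMeasure μ] (hf : BddMeas f) : Integrable f μ := by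
  obtain ⟨hf, C, hC⟩ := hf
  exact Integrable.of_bound hf.aestronglyMeasurable C (ae_of_all _ fun ω => hC ω)

theorem BddMeas.memLp [IsProbabilityMeasure μ] (hf : BddMeas f) : MemLp f 2 μ := by
  obtain ⟨hf, C, hC⟩ := hf
  exact MemLp.of_bound hf.aestronglyMeasurable C (ae_of_all _ fun ω => hC ω)

theorem bddMeas_partialSum {Y : ℕ → Ω → ℝ} (hY : ∀ j, BddMeas (Y j)) (m : ℕ) :
    BddMeas fun ω => partialSum (Y · ω) m :=
  BddMeas.sum _ fun j _ => hY j

theorem bddMeas_pairSum {Y : ℕ → Ω → ℝ} (hY : ∀ j, BddMeas (Y j)) (m : ℕ) :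
    BddMeas fun ω => pairSum (Y · ω) m :=
  BddMeas.sum _ fun j _ => (hY j).mul (bddMeas_partialSum hY j)

theorem partialSum_congr {y z : ℕ → ℝ} {m : ℕ} (h : ∀ j < m, y j = z j) :
    partialSum y m = partialSum z m :=
  Finset.sum_congr rfl fun j hj => h j (Finset.mem_range.1 hj)

theorem pairSum_congr {y z : ℕ → ℝ} {m : ℕ} (h : ∀ j < m, y j = z j) :
    pairSum y m = pairSum z m := by
  refine Finset.sum_congr rfl fun j hj => ?_
  rw [Finset.mem_range] at hj
  rw [h j hj, partialSum_congr fun k hk => h k (hk.trans hj)]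

theorem measurable_extend (m : ℕ) (j : ℕ) :
    Measurable fun z : Finset.range m → ℝ =>
      if h : j ∈ Finset.range m then z ⟨j, h⟩ else 0 := by
  split_ifs
  · exact measurable_pi_apply _
  · exact measurable_const

theorem measurable_pairSum {Ω' : Type*} [MeasurableSpace Ω'] {Y : Ω' → ℕ → ℝ}
    (hY : ∀ j, Measurable fun z => Y z j) (m : ℕ) : Measurable fun z => pairSum (Y z) m := by
  unfold pairSum partialSum
  fun_prop

theorem measurable_partialSum {Ω' : Type*} [MeasurableSpace Ω'] {Y : Ω' → ℕ → ℝ}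
    (hY : ∀ j, Measurable fun z => Y z j) (m : ℕ) : Measurable fun z => partialSum (Y z) m := by
  unfold partialSum
  fun_prop

/-- Both sums depend only on the observations before number `m`. This drives all the moment
recursions: adding one observation changes the sums by products of independent factors. -/
theorem indepFun_sums {Y : ℕ → Ω → ℝ} (hY : ∀ j, Measurable (Y j)) (hind : iIndepFun Y μ)
    (m : ℕ) :
    IndepFun (fun ω => (pairSum (Y · ω) m, partialSum (Y · ω) m)) (Y m) μ := by
  have h := hind.indepFun_finset (Finset.range m) {m} (by simp) hY
  have hψ : Measurable fun z : ({m} : Finset ℕ) → ℝ => z ⟨m, Finset.mem_singleton_self m⟩ :=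
    measurable_pi_apply _
  have h' := h.comp
    (φ := fun z => (pairSum (fun j => if h : j ∈ Finset.range m then z ⟨j, h⟩ else 0) m,
      partialSum (fun j => if h : j ∈ Finset.range m then z ⟨j, h⟩ else 0) m))
    ((measurable_pairSum (measurable_extend m) m).prodMk
      (measurable_partialSum (measurable_extend m) m)) hψ
  convert h' using 1
  ext ω
  · exact pairSum_congr fun j hj => by simp [hj]
  · exact partialSum_congr fun j hj => by simp [hj]
  · rfl

theorem integral_sums_mul {Y : ℕ → Ω → ℝ} (hY : ∀ j, Measurable (Y j)) (hind : iIndepFun Y μ)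
    (m : ℕ) {F : ℝ × ℝ → ℝ} {G : ℝ → ℝ} (hF : Measurable F) (hG : Measurable G) :
    ∫ ω, F (pairSum (Y · ω) m, partialSum (Y · ω) m) * G (Y m ω) ∂μ =
      (∫ ω, F (pairSum (Y · ω) m, partialSum (Y · ω) m) ∂μ) * ∫ ω, G (Y m ω) ∂μ :=
  ((indepFun_sums hY hind m).comp hF hG).integral_fun_mul_eq_mul_integral
    (hF.comp ((measurable_pairSum hY m).prodMk
      (measurable_partialSum hY m))).aestronglyMeasurable
    (hG.comp (hY m)).aestronglyMeasurable

section

variable [IsProbabilityMeasure μ] {Y : ℕ → Ω → ℝ} {δ v : ℝ}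

theorem integral_partialSum (hY : ∀ j, BddMeas (Y j)) (h1 : ∀ j, ∫ ω, Y j ω ∂μ = δ) (m : ℕ) :
    ∫ ω, partialSum (Y · ω) m ∂μ = m * δ := by
  simp only [partialSum]
  rw [integral_finsetSum _ fun j _ => (hY j).integrable]
  simp [h1]

theorem integral_partialSum_sq (hY : ∀ j, BddMeas (Y j)) (hind : iIndepFun Y μ)
    (h1 : ∀ j, ∫ ω, Y j ω ∂μ = δ) (h2 : ∀ j, ∫ ω, Y j ω ^ 2 ∂μ = v + δ ^ 2) (m : ℕ) :
    ∫ ω, partialSum (Y · ω) m ^ 2 ∂μ = m * v + m ^ 2 * δ ^ 2 := by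
  induction m with
  | zero => simp [partialSum]
  | succ m ih =>
    have hm := fun j => (hY j).1
    have hA := bddMeas_partialSum hY m
    have e (ω) : partialSum (Y · ω) (m + 1) ^ 2 =
        partialSum (Y · ω) m * partialSum (Y · ω) m +
          (2 * (partialSum (Y · ω) m * Y m ω) + Y m ω * Y m ω) := by
      simp only [partialSum, Finset.sum_range_succ]
      ring
    have i1 := integral_sums_mul hm hind m (F := Prod.snd) (G := id) measurable_snd measurable_id
    simp only [id] at i1
    simp only [pow_two] at ih h2 e ⊢
    simp only [e]
    rw [integral_add (hA.mul hA).integrable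
      (((hA.mul (hY m)).const_mul 2).add ((hY m).mul (hY m))).integrable,
      integral_add ((hA.mul (hY m)).const_mul 2).integrable ((hY m).mul (hY m)).integrable,
      integral_const_mul, i1, ih, h1, h2, integral_partialSum hY h1]
    push_cast
    ring

theorem integral_pairSum (hY : ∀ j, BddMeas (Y j)) (hind : iIndepFun Y μ)
    (h1 : ∀ j, ∫ ω, Y j ω ∂μ = δ) (m : ℕ) :
    ∫ ω, pairSum (Y · ω) m ∂μ = m * (m - 1) / 2 * δ ^ 2 := by
  induction m with
  | zero => simp [pairSum]
  | succ m ih =>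
    have hm := fun j => (hY j).1
    have hA := bddMeas_partialSum hY m
    have hT := bddMeas_pairSum hY m
    have e (ω) : pairSum (Y · ω) (m + 1) =
        pairSum (Y · ω) m + partialSum (Y · ω) m * Y m ω := by
      simp only [pairSum, Finset.sum_range_succ]
      ring
    have i1 := integral_sums_mul hm hind m (F := Prod.snd) (G := id) measurable_snd measurable_id
    simp only [id] at i1
    simp only [e]
    rw [integral_add hT.integrable (hA.mul (hY m)).integrable, i1, ih, h1,
      integral_partialSum hY h1]
    push_cast
    ring

/-- This mixed moment is the cross term in the recursion for the second moment of `pairSum`. -/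
theorem integral_pairSum_mul_partialSum (hY : ∀ j, BddMeas (Y j)) (hind : iIndepFun Y μ)
    (h1 : ∀ j, ∫ ω, Y j ω ∂μ = δ) (h2 : ∀ j, ∫ ω, Y j ω ^ 2 ∂μ = v + δ ^ 2) (m : ℕ) :
    ∫ ω, pairSum (Y · ω) m * partialSum (Y · ω) m ∂μ =
      m * (m - 1) / 2 * (m * δ ^ 3 + 2 * δ * v) := by
  induction m with
  | zero => simp [pairSum]
  | succ m ih =>
    have hm := fun j => (hY j).1
    have hA := bddMeas_partialSum hY m
    have hT := bddMeas_pairSum hY m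
    have e (ω) : pairSum (Y · ω) (m + 1) * partialSum (Y · ω) (m + 1) =
        pairSum (Y · ω) m * partialSum (Y · ω) m + (pairSum (Y · ω) m * Y m ω +
          (partialSum (Y · ω) m ^ 2 * Y m ω + partialSum (Y · ω) m * Y m ω ^ 2)) := by
      simp only [pairSum, partialSum, Finset.sum_range_succ]
      ring
    have i1 := integral_sums_mul hm hind m (F := Prod.fst) (G := id) measurable_fst measurable_id
    have i2 := integral_sums_mul hm hind m (F := fun z => z.2 ^ 2) (G := id)
      (by fun_prop) measurable_id
    have i3 := integral_sums_mul hm hind m (F := Prod.snd) (G := fun y => y ^ 2)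
      measurable_snd (by fun_prop)
    simp only [id] at i1 i2
    have hA2 : BddMeas fun ω => partialSum (Y · ω) m ^ 2 := by
      simpa only [pow_two] using hA.mul hA
    have hY2 : BddMeas fun ω => Y m ω ^ 2 := by
      simpa only [pow_two] using (hY m).mul (hY m)
    simp only [e]
    rw [integral_add (hT.mul hA).integrable
        ((hT.mul (hY m)).add ((hA2.mul (hY m)).add (hA.mul hY2))).integrable,
      integral_add (hT.mul (hY m)).integrable ((hA2.mul (hY m)).add (hA.mul hY2)).integrable,
      integral_add (hA2.mul (hY m)).integrable (hA.mul hY2).integrable,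
      i1, i2, i3, ih, h1, h2, integral_partialSum hY h1, integral_partialSum_sq hY hind h1 h2,
      integral_pairSum hY hind h1]
    push_cast
    ring

theorem integral_pairSum_sq (hY : ∀ j, BddMeas (Y j)) (hind : iIndepFun Y μ)
    (h1 : ∀ j, ∫ ω, Y j ω ∂μ = δ) (h2 : ∀ j, ∫ ω, Y j ω ^ 2 ∂μ = v + δ ^ 2) (m : ℕ) :
    ∫ ω, pairSum (Y · ω) m ^ 2 ∂μ = (m * (m - 1) / 2 * δ ^ 2) ^ 2 +
      m * (m - 1) / 2 * (v ^ 2 + 2 * (m - 1) * v * δ ^ 2) := by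
  induction m with
  | zero => simp [pairSum]
  | succ m ih =>
    have hm := fun j => (hY j).1
    have hA := bddMeas_partialSum hY m
    have hT := bddMeas_pairSum hY m
    have e (ω) : pairSum (Y · ω) (m + 1) ^ 2 =
        pairSum (Y · ω) m ^ 2 + (2 * (pairSum (Y · ω) m * partialSum (Y · ω) m * Y m ω) +
          partialSum (Y · ω) m ^ 2 * Y m ω ^ 2) := by
      simp only [pairSum, Finset.sum_range_succ]
      ring
    have i1 := integral_sums_mul hm hind m (F := fun z => z.1 * z.2) (G := id)
      (by fun_prop) measurable_id
    have i2 := integral_sums_mul hm hind m (F := fun z => z.2 ^ 2) (G := fun y => y ^ 2)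
      (by fun_prop) (by fun_prop)
    simp only [id] at i1 i2
    have hA2 : BddMeas fun ω => partialSum (Y · ω) m ^ 2 := by
      simpa only [pow_two] using hA.mul hA
    have hT2 : BddMeas fun ω => pairSum (Y · ω) m ^ 2 := by
      simpa only [pow_two] using hT.mul hT
    have hY2 : BddMeas fun ω => Y m ω ^ 2 := by
      simpa only [pow_two] using (hY m).mul (hY m)
    simp only [e]
    rw [integral_add hT2.integrable
        ((((hT.mul hA).mul (hY m)).const_mul 2).add (hA2.mul hY2)).integrable,
      integral_add (((hT.mul hA).mul (hY m)).const_mul 2).integrable (hA2.mul hY2).integrable,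
      integral_const_mul, i1, i2, ih, h1, h2, integral_pairSum_mul_partialSum hY hind h1 h2,
      integral_partialSum_sq hY hind h1 h2]
    push_cast
    ring

/-- The term `v²` comes from the `m(m-1)/2` products of fluctuations, the other one from the linear
part `(m-1) δ ∑ j, (Y j - δ)`. -/
theorem variance_pairSum (hY : ∀ j, BddMeas (Y j)) (hind : iIndepFun Y μ)
    (h1 : ∀ j, ∫ ω, Y j ω ∂μ = δ) (h2 : ∀ j, ∫ ω, Y j ω ^ 2 ∂μ = v + δ ^ 2) (m : ℕ) :
    variance (fun ω => pairSum (Y · ω) m) μ =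
      m * (m - 1) / 2 * (v ^ 2 + 2 * (m - 1) * v * δ ^ 2) := by
  rw [variance_eq_sub (bddMeas_pairSum hY m).memLp, integral_pairSum hY hind h1]
  simp only [Pi.pow_apply]
  rw [integral_pairSum_sq hY hind h1 h2]
  ring

end

section

variable {ι : Type*} {Y : ι → ℕ → Ω → ℝ} {δ v : ι → ℝ}

/-- The two statistics use disjoint blocks of the jointly independent family, so variances add over
coordinates. -/
theorem indepFun_pairSum (hY : ∀ i j, Measurable (Y i j))
    (hind : iIndepFun (fun p : ℕ × ι => Y p.2 p.1) μ) (m : ℕ) {a b : ι} (hab : a ≠ b) :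
    IndepFun (fun ω => pairSum (Y a · ω) m) (fun ω => pairSum (Y b · ω) m) μ := by
  classical
  have h := hind.indepFun_finset (Finset.range m ×ˢ {a}) (Finset.range m ×ˢ {b})
    (by
      rw [Finset.disjoint_left]
      rintro ⟨j, i⟩ h1 h2
      simp only [Finset.mem_product, Finset.mem_singleton] at h1 h2
      exact hab (h1.2.symm.trans h2.2)) (fun p => hY p.2 p.1)
  have hmeas (c : ι) (j : ℕ) : Measurable
      fun z : (Finset.range m ×ˢ {c} : Finset (ℕ × ι)) → ℝ =>
        if h : (j, c) ∈ Finset.range m ×ˢ {c} then z ⟨(j, c), h⟩ else 0 := by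
    split_ifs
    · exact measurable_pi_apply _
    · exact measurable_const
  have h' := h.comp (measurable_pairSum (hmeas a) m) (measurable_pairSum (hmeas b) m)
  convert h' using 1 <;>
  · ext ω
    exact pairSum_congr fun j hj => by simp [hj]

variable [IsProbabilityMeasure μ] [Fintype ι]

theorem integral_sum_pairSum (hY : ∀ i j, BddMeas (Y i j))
    (hind : iIndepFun (fun p : ℕ × ι => Y p.2 p.1) μ)
    (h1 : ∀ i j, ∫ ω, Y i j ω ∂μ = δ i) (w : ι → ℝ) (m : ℕ) :
    ∫ ω, ∑ i, w i * pairSum (Y i · ω) m ∂μ = m * (m - 1) / 2 * ∑ i, w i * δ i ^ 2 := by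
  have hi (i : ι) : iIndepFun (Y i) μ :=
    hind.precomp (g := fun j => (j, i)) fun a b h => (Prod.mk.inj h).1
  rw [integral_finsetSum _ fun i _ => ((bddMeas_pairSum (hY i) m).const_mul _).integrable,
    Finset.mul_sum]
  refine Finset.sum_congr rfl fun i _ => ?_
  rw [integral_const_mul, integral_pairSum (hY i) (hi i) (h1 i)]
  ring

theorem variance_sum_pairSum (hY : ∀ i j, BddMeas (Y i j))
    (hind : iIndepFun (fun p : ℕ × ι => Y p.2 p.1) μ)
    (h1 : ∀ i j, ∫ ω, Y i j ω ∂μ = δ i) (h2 : ∀ i j, ∫ ω, Y i j ω ^ 2 ∂μ = v i + δ i ^ 2)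
    (w : ι → ℝ) (m : ℕ) :
    variance (fun ω => ∑ i, w i * pairSum (Y i · ω) m) μ =
      m * (m - 1) / 2 * ∑ i, w i ^ 2 * (v i ^ 2 + 2 * (m - 1) * v i * δ i ^ 2) := by
  have hi (i : ι) : iIndepFun (Y i) μ :=
    hind.precomp (g := fun j => (j, i)) fun a b h => (Prod.mk.inj h).1
  have h := IndepFun.variance_sum (μ := μ) (s := Finset.univ)
    (X := fun i ω => w i * pairSum (Y i · ω) m)
    (fun i _ => ((bddMeas_pairSum (hY i) m).const_mul _).memLp)
    (fun a _ b _ hab => (indepFun_pairSum (fun i j => (hY i j).1) hind m hab).comp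
      (measurable_const_mul (w a)) (measurable_const_mul (w b)))
  have e : (∑ i, fun ω => w i * pairSum (Y i · ω) m) =
      fun ω => ∑ i, w i * pairSum (Y i · ω) m := by
    ext ω
    simp
  rw [← e, h, Finset.mul_sum]
  refine Finset.sum_congr rfl fun i _ => ?_
  rw [variance_const_mul, variance_pairSum (hY i) (hi i) (h1 i) (h2 i)]
  ring

end

end Moments

/-! ### Bhattacharyya coefficient and total variation -/

section Affinity

/-- The Bhattacharyya coefficient of two mass functions. -/
noncomputable def affinity {α : Type*} [Fintype α] (a b : α → ℝ) : ℝ := ∑ x, √(a x * b x)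

variable {α : Type*} [Fintype α] {a b : α → ℝ}

theorem sum_sq_sqrt_sub (ha : ∀ x, 0 ≤ a x) (hb : ∀ x, 0 ≤ b x) (ha1 : ∑ x, a x = 1)
    (hb1 : ∑ x, b x = 1) : ∑ x, (√(a x) - √(b x)) ^ 2 = 2 * (1 - affinity a b) := by
  have e (x) : (√(a x) - √(b x)) ^ 2 = a x + b x - 2 * √(a x * b x) := by
    rw [Real.sqrt_mul (ha x), sub_sq, Real.sq_sqrt (ha x), Real.sq_sqrt (hb x)]
    ring
  simp only [e]
  rw [Finset.sum_sub_distrib, Finset.sum_add_distrib, ha1, hb1, ← Finset.mul_sum, affinity]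
  ring

theorem sq_sqrt_sub_le_abs {s t : ℝ} (hs : 0 ≤ s) (ht : 0 ≤ t) : (√s - √t) ^ 2 ≤ |s - t| := by
  have e : s - t = (√s - √t) * (√s + √t) := by
    nlinarith [Real.sq_sqrt hs, Real.sq_sqrt ht]
  rw [e, abs_mul, ← sq_abs, pow_two]
  refine mul_le_mul_of_nonneg_left ?_ (abs_nonneg _)
  rw [abs_of_nonneg (add_nonneg (Real.sqrt_nonneg s) (Real.sqrt_nonneg t)), abs_le]
  constructor <;> linarith [Real.sqrt_nonneg s, Real.sqrt_nonneg t]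

theorem one_sub_affinity_le (ha : ∀ x, 0 ≤ a x) (hb : ∀ x, 0 ≤ b x) (ha1 : ∑ x, a x = 1)
    (hb1 : ∑ x, b x = 1) : 1 - affinity a b ≤ 1 / 2 * ∑ x, |a x - b x| := by
  have h := sum_sq_sqrt_sub ha hb ha1 hb1
  have h2 : ∑ x, (√(a x) - √(b x)) ^ 2 ≤ ∑ x, |a x - b x| :=
    Finset.sum_le_sum fun x _ => sq_sqrt_sub_le_abs (ha x) (hb x)
  linarith

/-- Factor `a - b = (√a - √b)(√a + √b)` and apply Cauchy–Schwarz; the second factor contributes at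
most `∑ (2a + 2b) = 4`. -/
theorem sq_sum_abs_sub_le (ha : ∀ x, 0 ≤ a x) (hb : ∀ x, 0 ≤ b x) (ha1 : ∑ x, a x = 1)
    (hb1 : ∑ x, b x = 1) :
    (1 / 2 * ∑ x, |a x - b x|) ^ 2 ≤ 2 * (1 - affinity a b) := by
  have h := sum_sq_sqrt_sub ha hb ha1 hb1
  have e (x) : |a x - b x| = |√(a x) - √(b x)| * (√(a x) + √(b x)) := by
    have : a x - b x = (√(a x) - √(b x)) * (√(a x) + √(b x)) := by
      nlinarith [Real.sq_sqrt (ha x), Real.sq_sqrt (hb x)]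
    rw [this, abs_mul, abs_of_nonneg (add_nonneg (Real.sqrt_nonneg (a x)) (Real.sqrt_nonneg _))]
  have h2 : (∑ x, |a x - b x|) ^ 2 ≤
      (∑ x, |√(a x) - √(b x)| ^ 2) * ∑ x, (√(a x) + √(b x)) ^ 2 := by
    simp only [e]
    exact Finset.sum_mul_sq_le_sq_mul_sq _ _ _
  have h3 : ∑ x, (√(a x) + √(b x)) ^ 2 ≤ 4 := by
    have : ∑ x, (√(a x) + √(b x)) ^ 2 ≤ ∑ x, (2 * a x + 2 * b x) :=
      Finset.sum_le_sum fun x _ => by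
        nlinarith [Real.sq_sqrt (ha x), Real.sq_sqrt (hb x), sq_nonneg (√(a x) - √(b x))]
    rw [Finset.sum_add_distrib, ← Finset.mul_sum, ← Finset.mul_sum, ha1, hb1] at this
    linarith
  simp only [sq_abs, h] at h2
  have h4 : 0 ≤ 2 * (1 - affinity a b) := h ▸ Finset.sum_nonneg fun x _ => sq_nonneg _
  nlinarith [mul_le_mul_of_nonneg_left h3 h4]

theorem affinity_prod {n : ℕ} {β : Type*} [Fintype β] {f g : Fin n → β → ℝ}
    (hf : ∀ i b, 0 ≤ f i b) (hg : ∀ i b, 0 ≤ g i b) :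
    affinity (fun x : Fin n → β => ∏ i, f i (x i)) (fun x => ∏ i, g i (x i)) =
      ∏ i, affinity (f i) (g i) := by
  simp only [affinity]
  rw [Finset.prod_univ_sum, Fintype.piFinset_univ]
  refine Finset.sum_congr rfl fun x _ => ?_
  rw [← Finset.prod_mul_distrib, Real.sqrt_prod _ fun i _ => mul_nonneg (hf i _) (hg i _)]

theorem one_sub_sum_le_prod {ι : Type*} (s : Finset ι) {f : ι → ℝ} (h0 : ∀ i, 0 ≤ f i)
    (h1 : ∀ i, f i ≤ 1) : 1 - ∑ i ∈ s, (1 - f i) ≤ ∏ i ∈ s, f i := by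
  classical
  induction s using Finset.induction_on with
  | empty => simp
  | insert a s ha ih =>
    rw [Finset.sum_insert ha, Finset.prod_insert ha]
    have hp : ∏ i ∈ s, f i ≤ 1 := Finset.prod_le_one (fun i _ => h0 i) fun i _ => h1 i
    nlinarith [h0 a, h1 a]

/-- The mass function of a bit with mean `p`. -/
def bernoulliMass (p : ℝ) (b : Bool) : ℝ := if b then p else 1 - p

theorem bernoulliMass_nonneg {p : ℝ} (h0 : 0 ≤ p) (h1 : p ≤ 1) (b : Bool) :
    0 ≤ bernoulliMass p b := by
  cases b <;> simp [bernoulliMass, h0, h1]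

theorem sum_bernoulliMass (p : ℝ) : ∑ b, bernoulliMass p b = 1 := by
  simp [bernoulliMass]

theorem affinity_bernoulliMass_le_one {p q : ℝ} (hp0 : 0 ≤ p) (hp1 : p ≤ 1) (hq0 : 0 ≤ q)
    (hq1 : q ≤ 1) : affinity (bernoulliMass p) (bernoulliMass q) ≤ 1 := by
  have h := sum_sq_sqrt_sub (bernoulliMass_nonneg hp0 hp1) (bernoulliMass_nonneg hq0 hq1)
    (sum_bernoulliMass p) (sum_bernoulliMass q)
  have : 0 ≤ 2 * (1 - affinity (bernoulliMass p) (bernoulliMass q)) :=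
    h ▸ Finset.sum_nonneg fun x _ => sq_nonneg _
  linarith

theorem sq_sqrt_sub_mul_le {s t : ℝ} (hs : 0 ≤ s) (ht : 0 ≤ t) :
    (√s - √t) ^ 2 * t ≤ (s - t) ^ 2 := by
  have e : s - t = (√s - √t) * (√s + √t) := by
    nlinarith [Real.sq_sqrt hs, Real.sq_sqrt ht]
  rw [e, mul_pow]
  refine mul_le_mul_of_nonneg_left ?_ (sq_nonneg _)
  nlinarith [Real.sqrt_nonneg s, Real.sqrt_nonneg t, Real.sq_sqrt ht, Real.sq_sqrt hs]

/-- With `H` the left side and `u = q(1-q)`, both `H ≤ |p-q|` and `H u ≤ (p-q)²/2` hold. Hence `H (u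
+ γ) ≤ (p-q)²/2 + γ|p-q| ≤ (p-q)² + γ²/2`. The additive `γ/2` is the price for regularizing the
denominator. -/
theorem one_sub_affinity_bernoulliMass_le {p q γ : ℝ} (hp0 : 0 ≤ p) (hp1 : p ≤ 1) (hq0 : 0 ≤ q)
    (hq1 : q ≤ 1) (hγ : 0 < γ) :
    1 - affinity (bernoulliMass p) (bernoulliMass q) ≤
      (p - q) ^ 2 / (q * (1 - q) + γ) + γ / 2 := by
  have h := sum_sq_sqrt_sub (bernoulliMass_nonneg hp0 hp1) (bernoulliMass_nonneg hq0 hq1)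
    (sum_bernoulliMass p) (sum_bernoulliMass q)
  set H := 1 - affinity (bernoulliMass p) (bernoulliMass q)
  simp only [Fintype.sum_bool, bernoulliMass, if_true, Bool.false_eq_true, if_false] at h
  have hu : 0 ≤ q * (1 - q) := mul_nonneg hq0 (by linarith)
  have a1 := sq_sqrt_sub_le_abs hp0 hq0
  have a2 := sq_sqrt_sub_le_abs (s := 1 - p) (t := 1 - q) (by linarith) (by linarith)
  have b1 := mul_le_mul_of_nonneg_right (sq_sqrt_sub_mul_le hp0 hq0) (by linarith : 0 ≤ 1 - q)
  have b2 := mul_le_mul_of_nonneg_right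
    (sq_sqrt_sub_mul_le (s := 1 - p) (t := 1 - q) (by linarith) (by linarith)) hq0
  have e : (1 - p) - (1 - q) = -(p - q) := by ring
  rw [e, abs_neg] at a2
  rw [e, neg_sq] at b2
  have h1 : H ≤ |p - q| := by linarith
  have h2 : H * (q * (1 - q)) ≤ (p - q) ^ 2 / 2 := by
    linear_combination (1 / 2 : ℝ) * b1 + (1 / 2 : ℝ) * b2 - (1 / 2 : ℝ) * (q * (1 - q)) * h
  rw [← sub_le_iff_le_add, le_div_iff₀ (by linarith)]
  have h3 := mul_le_mul_of_nonneg_right h1 hγ.le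
  nlinarith [sq_nonneg (|p - q| - γ), sq_abs (p - q), mul_nonneg hu hγ.le]

end Affinity

/-! ### Product distributions on the cube -/

section Product

variable {n : ℕ}

theorem real_pi_singleton (μ : Fin n → Measure Bool) [∀ i, IsProbabilityMeasure (μ i)]
    (x : Cube n) :
    (Measure.pi μ).real {x} = ∏ i, bernoulliMass ((μ i).real {true}) (x i) := by
  rw [Measure.real, Measure.pi_singleton, ENNReal.toReal_prod]
  refine Finset.prod_congr rfl fun i _ => ?_
  cases hx : x i
  · have : ({false} : Set Bool) = {true}ᶜ := by ext b; cases b <;> simp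
    change (μ i).real _ = _
    rw [this, probReal_compl_eq_one_sub (by simp)]
    simp [bernoulliMass]
  · simp [bernoulliMass, Measure.real]

theorem coordMean_pi (μ : Fin n → Measure Bool) [∀ i, IsProbabilityMeasure (μ i)] (i : Fin n) :
    coordMean (Measure.pi μ) i = (μ i).real {true} := by
  have h := (measurePreserving_eval μ i).measure_preimage (s := {true})
    (MeasurableSet.of_discrete.nullMeasurableSet)
  rw [coordMean, Measure.real, Measure.real, ← h]
  rfl

theorem coordMean_nonneg (P : Measure (Cube n)) (i : Fin n) : 0 ≤ coordMean P i :=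
  measureReal_nonneg

theorem coordMean_le_one (P : Measure (Cube n)) [IsProbabilityMeasure P] (i : Fin n) :
    coordMean P i ≤ 1 :=
  measureReal_le_one

theorem IsProductDistribution.real_singleton {P : Measure (Cube n)}
    (hP : IsProductDistribution P) (x : Cube n) :
    P.real {x} = ∏ i, bernoulliMass (coordMean P i) (x i) := by
  obtain ⟨μ, hμ, rfl⟩ := hP
  simp only [real_pi_singleton, coordMean_pi]

theorem sum_real_singleton (P : Measure (Cube n)) [IsProbabilityMeasure P] :
    ∑ x, P.real {x} = 1 := by
  have h := sum_measureReal_singleton (μ := P) Finset.univ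
  rw [h]
  simp

/-- The coefficient factorizes over coordinates, and one minus a product is at most the sum of the
deficits; each deficit is bounded by the one-bit estimate. -/
theorem sq_tvDist_le {P Q : Measure (Cube n)} [IsProbabilityMeasure P] [IsProbabilityMeasure Q]
    (hP : IsProductDistribution P) (hQ : IsProductDistribution Q) {γ : ℝ} (hγ : 0 < γ) :
    tvDist P Q ^ 2 ≤ 2 * ∑ i, (coordMean P i - coordMean Q i) ^ 2 /
      (coordMean Q i * (1 - coordMean Q i) + γ) + n * γ := by
  have h := sq_sum_abs_sub_le (a := fun x => P.real {x}) (b := fun x => Q.real {x})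
    (fun _ => measureReal_nonneg) (fun _ => measureReal_nonneg)
    (sum_real_singleton P) (sum_real_singleton Q)
  rw [tvDist]
  refine h.trans ?_
  simp only [hP.real_singleton, hQ.real_singleton]
  have p0 := coordMean_nonneg P
  have q0 := coordMean_nonneg Q
  have p1 := coordMean_le_one P
  have q1 := coordMean_le_one Q
  rw [affinity_prod (fun i => bernoulliMass_nonneg (p0 i) (p1 i))
    (fun i => bernoulliMass_nonneg (q0 i) (q1 i))]
  have h2 := one_sub_sum_le_prod Finset.univ
    (f := fun i => affinity (bernoulliMass (coordMean P i)) (bernoulliMass (coordMean Q i)))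
    (fun i => Finset.sum_nonneg fun _ _ => Real.sqrt_nonneg _)
    (fun i => affinity_bernoulliMass_le_one (p0 i) (p1 i) (q0 i) (q1 i))
  have h3 := Finset.sum_le_sum fun i (_ : i ∈ Finset.univ) =>
    one_sub_affinity_bernoulliMass_le (p0 i) (p1 i) (q0 i) (q1 i) hγ
  rw [Finset.sum_add_distrib] at h3
  simp only [Finset.sum_const, Finset.card_univ, Fintype.card_fin, nsmul_eq_mul] at h3
  linarith

end Product

/-! ### Mean and variance of the test statistic -/

section SourceMoments

open ProbabilityTheory

theorem _root_.ProbabilityTheory.iIndepFun.comp_measurePreserving {Ω Ω' ι : Type*}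
    {mΩ : MeasurableSpace Ω} {mΩ' : MeasurableSpace Ω'} {μ : Measure Ω} {ν : Measure Ω'}
    {β : ι → Type*} {m : ∀ i, MeasurableSpace (β i)} {X : ∀ i, Ω' → β i} {f : Ω → Ω'}
    (h : iIndepFun X ν) (hX : ∀ i, Measurable (X i)) (hf : MeasurePreserving f μ ν) :
    iIndepFun (fun i ω => X i (f ω)) μ := by
  rw [iIndepFun_iff_measure_inter_preimage_eq_mul] at h ⊢
  intro S sets hs
  have h' := h S hs
  rw [← hf.measure_preimage (Finset.measurableSet_biInter S
    fun i hi => hX i (hs i hi)).nullMeasurableSet] at h'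
  simp only [Set.preimage_iInter] at h'
  refine h'.trans (Finset.prod_congr rfl fun i hi => ?_)
  rw [← hf.measure_preimage (hX i (hs i hi)).nullMeasurableSet]
  rfl

variable {n : ℕ} {P : Measure (Cube n)} [IsProbabilityMeasure P]

instance : IsProbabilityMeasure (sourceLaw P) := by
  unfold sourceLaw
  infer_instance

theorem measurePreserving_sample (P : Measure (Cube n)) [IsProbabilityMeasure P] (j : ℕ) :
    MeasurePreserving (fun ω : Source n => ω.1 j) (sourceLaw P) P :=
  (measurePreserving_eval_infinitePi (fun _ : ℕ => P) j).comp measurePreserving_fst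

/-- Independence across samples and, within one sample, across coordinates combine to joint
independence of the double family. -/
theorem iIndepFun_bits (hP : IsProductDistribution P) :
    iIndepFun (fun (p : ℕ × Fin n) (ω : Source n) => ω.1 p.1 p.2) (sourceLaw P) := by
  refine iIndepFun_uncurry' (X := fun (j : ℕ) (i : Fin n) (ω : Source n) => ω.1 j i)
    (fun i j => by fun_prop) ?_ fun j => ?_
  · exact (iIndepFun_infinitePi (P := fun _ : ℕ => P) (X := fun _ => id)
      fun _ => measurable_id).comp_measurePreserving (fun i => by fun_prop) measurePreserving_fst
  · have h : iIndepFun (fun (i : Fin n) (x : Cube n) => x i) P := by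
      obtain ⟨μ, hμ, rfl⟩ := hP
      exact iIndepFun_pi (X := fun _ => id) fun _ => aemeasurable_id
    exact h.comp_measurePreserving (fun i => by fun_prop) (measurePreserving_sample P j)

theorem integral_coord (P : Measure (Cube n)) [IsProbabilityMeasure P] (i : Fin n) (j : ℕ)
    (F : Bool → ℝ) :
    ∫ ω, F (ω.1 j i) ∂sourceLaw P =
      coordMean P i * F true + (1 - coordMean P i) * F false := by
  have h1 : ∫ ω, F (ω.1 j i) ∂sourceLaw P = ∫ x : Cube n, F (x i) ∂P := by
    have h := integral_map (μ := sourceLaw P) (φ := fun ω : Source n => ω.1 j) (by fun_prop)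
      (measurable_of_finite fun x : Cube n => F (x i)).aestronglyMeasurable
    rw [(measurePreserving_sample P j).map_eq] at h
    exact h.symm
  have h2 : ∫ x : Cube n, F (x i) ∂P = ∫ b, F b ∂(P.map fun x => x i) := by
    rw [integral_map (measurable_pi_apply i).aemeasurable
      (measurable_of_finite _).aestronglyMeasurable]
  have : IsProbabilityMeasure (P.map fun x : Cube n => x i) :=
    Measure.isProbabilityMeasure_map (measurable_pi_apply i).aemeasurable
  have ht : (P.map fun x : Cube n => x i).real {true} = coordMean P i := by
    rw [map_measureReal_apply (measurable_pi_apply i) (by simp)]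
    rfl
  have hf : (P.map fun x : Cube n => x i).real {false} = 1 - coordMean P i := by
    have : ({false} : Set Bool) = {true}ᶜ := by ext b; cases b <;> simp
    rw [this, probReal_compl_eq_one_sub (by simp), ht]
  rw [h1, h2, integral_fintype .of_finite, Fintype.sum_bool, ht, hf, smul_eq_mul, smul_eq_mul]

theorem observation_eq (q : Fin n → ℝ) (ω : Source n) (i : Fin n) (j : ℕ) :
    observation q ω i j = bitVal (ω.1 j i) - q i := by
  simp [observation, sampleBit, param]

theorem statistic_eq (ε : ℝ) (q : Fin n → ℝ) (ω : Source n) (r : ℕ) :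
    statistic ε q ω r = ∑ i : Fin n, (q i * (1 - q i) + ε ^ 2 / (4 * n))⁻¹ *
      pairSum (fun j => bitVal (ω.1 j i) - q i) r := by
  rw [statistic, Finset.sum_range]
  refine Finset.sum_congr rfl fun i _ => ?_
  rw [div_eq_inv_mul, regVar]
  congr 2
  · simp [param]
  · ext j
    exact observation_eq q ω i j

theorem bddMeas_bit (q : Fin n → ℝ) (i : Fin n) (j : ℕ) :
    BddMeas fun ω : Source n => bitVal (ω.1 j i) - q i := by
  refine ⟨((measurable_of_finite bitVal).comp
    (by fun_prop : Measurable fun ω : Source n => ω.1 j i)).sub_const _, 1 + |q i|, fun ω => ?_⟩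
  refine (abs_sub _ _).trans (add_le_add_left ?_ _)
  cases ω.1 j i <;> simp [bitVal]

theorem iIndepFun_observations (hP : IsProductDistribution P) (q : Fin n → ℝ) :
    iIndepFun (fun (p : ℕ × Fin n) (ω : Source n) => bitVal (ω.1 p.1 p.2) - q p.2)
      (sourceLaw P) :=
  (iIndepFun_bits hP).comp (fun p b => bitVal b - q p.2) fun _ => measurable_of_finite _

theorem bddMeas_statistic (ε : ℝ) (q : Fin n → ℝ) (m : ℕ) :
    BddMeas fun ω : Source n => statistic ε q ω m := by
  simp only [statistic_eq]
  exact BddMeas.sum _ fun i _ => (bddMeas_pairSum (fun j => bddMeas_bit q i j) m).const_mul _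

theorem integral_statistic (hP : IsProductDistribution P) (ε : ℝ) (q : Fin n → ℝ) (m : ℕ) :
    ∫ ω, statistic ε q ω m ∂sourceLaw P = m * (m - 1) / 2 *
      ∑ i, (q i * (1 - q i) + ε ^ 2 / (4 * n))⁻¹ * (coordMean P i - q i) ^ 2 := by
  have h1 (i : Fin n) (j : ℕ) :
      ∫ ω, (bitVal (ω.1 j i) - q i) ∂sourceLaw P = coordMean P i - q i := by
    rw [integral_coord P i j fun b => bitVal b - q i]
    simp only [bitVal, if_true, Bool.false_eq_true, if_false]
    ring
  simp only [statistic_eq]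
  exact integral_sum_pairSum (Y := fun i j (ω : Source n) => bitVal (ω.1 j i) - q i)
    (bddMeas_bit q) (iIndepFun_observations hP q) h1
    (fun i => (q i * (1 - q i) + ε ^ 2 / (4 * n))⁻¹) m

theorem variance_statistic (hP : IsProductDistribution P) (ε : ℝ) (q : Fin n → ℝ) (m : ℕ) :
    variance (fun ω => statistic ε q ω m) (sourceLaw P) = m * (m - 1) / 2 *
      ∑ i, (q i * (1 - q i) + ε ^ 2 / (4 * n))⁻¹ ^ 2 *
        ((coordMean P i * (1 - coordMean P i)) ^ 2 +
          2 * (m - 1) * (coordMean P i * (1 - coordMean P i)) * (coordMean P i - q i) ^ 2) := by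
  have h1 (i : Fin n) (j : ℕ) :
      ∫ ω, (bitVal (ω.1 j i) - q i) ∂sourceLaw P = coordMean P i - q i := by
    rw [integral_coord P i j fun b => bitVal b - q i]
    simp only [bitVal, if_true, Bool.false_eq_true, if_false]
    ring
  have h2 (i : Fin n) (j : ℕ) :
      ∫ ω, (bitVal (ω.1 j i) - q i) ^ 2 ∂sourceLaw P =
        coordMean P i * (1 - coordMean P i) + (coordMean P i - q i) ^ 2 := by
    rw [integral_coord P i j fun b => (bitVal b - q i) ^ 2]
    simp only [bitVal, if_true, Bool.false_eq_true, if_false]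
    ring
  simp only [statistic_eq]
  exact variance_sum_pairSum (Y := fun i j (ω : Source n) => bitVal (ω.1 j i) - q i)
    (bddMeas_bit q) (iIndepFun_observations hP q) h1 h2
    (fun i => (q i * (1 - q i) + ε ^ 2 / (4 * n))⁻¹) m

/-- Chebyshev's inequality. -/
theorem real_deviation_le {Ω : Type*} [MeasurableSpace Ω] {μ : Measure Ω}
    [IsProbabilityMeasure μ] {Z : Ω → ℝ} (hZ : BddMeas Z) {s : Set Ω} {c b : ℝ} (hc : 0 < c)
    (hs : ∀ ω ∈ s, c ≤ |Z ω - ∫ ω, Z ω ∂μ|) (hb : variance Z μ ≤ b * c ^ 2) : μ.real s ≤ b := by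
  have h := meas_ge_le_variance_div_sq hZ.memLp hc (μ := μ)
  have h2 : μ s ≤ ENNReal.ofReal (variance Z μ / c ^ 2) := (measure_mono hs).trans h
  have h3 : variance Z μ / c ^ 2 ≤ b := by rwa [div_le_iff₀ (by positivity)]
  refine (ENNReal.toReal_mono ENNReal.ofReal_ne_top h2).trans ?_
  rw [ENNReal.toReal_ofReal (div_nonneg (variance_nonneg _ _) (sq_nonneg _))]
  exact h3

end SourceMoments

/-! ### Variance estimate in the far case -/

section Numeric

theorem variance_bound {n : ℕ} {ε m : ℝ} {p q : Fin n → ℝ} (hn : 1 ≤ n) (hε : 0 < ε)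
    (hm : 1 ≤ m) (hp0 : ∀ i, 0 ≤ p i) (hp1 : ∀ i, p i ≤ 1) (hq0 : ∀ i, 0 ≤ q i)
    (hq1 : ∀ i, q i ≤ 1) {w : Fin n → ℝ}
    (hw : ∀ i, w i = (q i * (1 - q i) + ε ^ 2 / (4 * n))⁻¹)
    {S : ℝ} (hS : S = ∑ i, w i * (p i - q i) ^ 2) (hSε : 3 / 8 * ε ^ 2 ≤ S)
    (hmn : 1048576 * n ≤ (m * ε ^ 2) ^ 2) :
    ∑ i, w i ^ 2 * ((p i * (1 - p i)) ^ 2 + 2 * (m - 1) * (p i * (1 - p i)) * (p i - q i) ^ 2) ≤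
      m ^ 2 * S ^ 2 / 48 := by
  have hn' : (1 : ℝ) ≤ n := by exact_mod_cast hn
  have hγ : 0 < ε ^ 2 / (4 * n) := by positivity
  have hu (i) : 0 ≤ q i * (1 - q i) := mul_nonneg (hq0 i) (by linarith [hq1 i])
  have hv (i) : 0 ≤ p i * (1 - p i) := mul_nonneg (hp0 i) (by linarith [hp1 i])
  have hw0 (i) : 0 < w i := by
    rw [hw]
    exact inv_pos.2 (by linarith [hu i])
  have ha0 (i) : 0 ≤ w i * (p i - q i) ^ 2 := mul_nonneg (hw0 i).le (sq_nonneg _)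
  have haS (i) : w i * (p i - q i) ^ 2 ≤ S :=
    hS ▸ Finset.single_le_sum (f := fun i => w i * (p i - q i) ^ 2) (fun j _ => ha0 j)
      (Finset.mem_univ i)
  have hwW (i) : w i ≤ 4 * n / ε ^ 2 := by
    rw [hw, ← inv_div (ε ^ 2) (4 * (n : ℝ))]
    exact inv_anti₀ hγ (by linarith [hu i])
  have hwu (i) : w i * (q i * (1 - q i)) ≤ 1 := by
    rw [hw, inv_mul_le_iff₀ (by linarith [hu i])]
    linarith
  have hS0 : 0 < S := lt_of_lt_of_le (by positivity) hSε
  set W := 4 * n / ε ^ 2 with hW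
  have hW0 : 0 < W := by positivity
  set b := √(W * S) with hb
  have hb0 : 0 ≤ b := Real.sqrt_nonneg _
  have hb2 : b ^ 2 = W * S := Real.sq_sqrt (by positivity)
  have hd (i) : w i * |p i - q i| ≤ b := by
    refine Real.le_sqrt_of_sq_le ?_
    rw [mul_pow, sq_abs]
    nlinarith [mul_le_mul (hwW i) (haS i) (ha0 i) hW0.le]
  -- The weights are built from `q` while the variance is that of `p`; replacing one by the other
  -- costs at most `|p i - q i|`.
  have hwv (i) : w i * (p i * (1 - p i)) ≤ 1 + w i * |p i - q i| := by
    have h1 : p i * (1 - p i) ≤ q i * (1 - q i) + |p i - q i| := by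
      have : p i * (1 - p i) - q i * (1 - q i) = (p i - q i) * (1 - p i - q i) := by ring
      have h2 : (p i - q i) * (1 - p i - q i) ≤ |p i - q i| := by
        refine (le_abs_self _).trans ?_
        rw [abs_mul]
        refine mul_le_of_le_one_right (abs_nonneg _) ?_
        rw [abs_le]
        constructor <;> linarith [hp0 i, hp1 i, hq0 i, hq1 i]
      linarith
    nlinarith [mul_le_mul_of_nonneg_left h1 (hw0 i).le, hwu i]
  have hterm (i) : w i ^ 2 * ((p i * (1 - p i)) ^ 2 +
        2 * (m - 1) * (p i * (1 - p i)) * (p i - q i) ^ 2) ≤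
      2 + (2 * W + 2 * m * (1 + b)) * (w i * (p i - q i) ^ 2) := by
    have hwv0 : 0 ≤ w i * (p i * (1 - p i)) := mul_nonneg (hw0 i).le (hv i)
    have h1 : (w i * (p i * (1 - p i))) ^ 2 ≤ 2 + 2 * W * (w i * (p i - q i) ^ 2) := by
      have h2 : (w i * |p i - q i|) ^ 2 ≤ W * (w i * (p i - q i) ^ 2) := by
        rw [mul_pow, sq_abs]
        nlinarith [mul_le_mul_of_nonneg_right (hwW i) (ha0 i)]
      nlinarith [pow_le_pow_left₀ hwv0 (hwv i) 2, sq_nonneg (1 - w i * |p i - q i|)]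
    have h3 : (m - 1) * ((w i * (p i * (1 - p i))) * (w i * (p i - q i) ^ 2)) ≤
        m * ((1 + b) * (w i * (p i - q i) ^ 2)) := by
      refine mul_le_mul (by linarith) ?_ (mul_nonneg hwv0 (ha0 i)) (by linarith)
      exact mul_le_mul_of_nonneg_right (by linarith [hwv i, hd i]) (ha0 i)
    nlinarith
  refine (Finset.sum_le_sum fun i _ => hterm i).trans ?_
  rw [Finset.sum_add_distrib, ← Finset.mul_sum, ← hS]
  simp only [Finset.sum_const, Finset.card_univ, Fintype.card_fin, nsmul_eq_mul]
  -- It remains to bound `2n + 2WS + 2x + 2xb` by `x²/48`. Since `x ≥ 384 √n`, each of the four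
  -- terms is a small multiple of `x²`.
  set x := m * S with hx
  have hxe : 3 / 8 * (m * ε ^ 2) ≤ x := by
    rw [hx]
    nlinarith
  have hme : 0 < m * ε ^ 2 := by positivity
  have hxn : 147456 * n ≤ x ^ 2 := by
    have := pow_le_pow_left₀ (by positivity) hxe 2
    nlinarith
  have hx0 : 0 < x := by positivity
  have hx384 : 384 ≤ x := by
    refine le_of_sq_le_sq ?_ hx0.le
    nlinarith
  have hWS : W * S ≤ x ^ 2 / 65536 := by
    have h1 : W * S ≤ 4 * S * (m ^ 2 * ε ^ 2) / 1048576 := by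
      rw [hW, div_mul_eq_mul_div, div_le_iff₀ (by positivity)]
      nlinarith
    refine h1.trans ?_
    have h2 : m ^ 2 * ε ^ 2 * S ≤ 8 / 3 * x ^ 2 := by
      rw [hx]
      have : 0 ≤ m ^ 2 * S := by positivity
      nlinarith
    nlinarith
  have hbx : b ≤ x / 256 := by
    refine le_of_sq_le_sq ?_ (by positivity)
    rw [hb2]
    nlinarith
  have hxb : x * b ≤ x ^ 2 / 256 := by nlinarith
  have : (2 * W + 2 * m * (1 + b)) * S = 2 * (W * S) + 2 * x + 2 * (x * b) := by
    rw [hx]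
    ring
  rw [this, ← mul_pow, ← hx]
  nlinarith

end Numeric

/-! ### Correctness and cost of the tester -/

section Tester

open ProbabilityTheory

theorem card_bounds {n : ℕ} {ε m : ℝ} (hn : 1 ≤ n) (hε1 : ε ≤ 1) (hε : 0 < ε) (hm0 : 0 ≤ m)
    (hm : 1048576 * n ≤ (m * ε ^ 2) ^ 2) : 1024 ≤ m := by
  have hn' : (1 : ℝ) ≤ n := by exact_mod_cast hn
  have h1 : 1024 ≤ m * ε ^ 2 := le_of_sq_le_sq (by linarith) (by positivity)
  have h2 : ε ^ 2 ≤ 1 := pow_le_one₀ hε.le hε1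
  nlinarith

/-- The mean is zero, and as each weight times the variance of its bit is at most 1, the variance is
at most `m² n / 2`. -/
theorem real_reject_le {n : ℕ} {ε : ℝ} {m : ℕ} {Q : Measure (Cube n)} [IsProbabilityMeasure Q]
    (hQ : IsProductDistribution Q) (hn : 1 ≤ n) (hε : 0 < ε) (hε1 : ε ≤ 1)
    (hm : 1048576 * n ≤ (m * ε ^ 2) ^ 2) :
    (sourceLaw Q).real {ω | (m * ε ^ 2) ^ 2 / 32 ≤
      statistic ε (coordMean Q) ω m * ε ^ 2} ≤ 1 / 3 := by
  have hm1 : (1024 : ℝ) ≤ m := card_bounds hn hε1 hε m.cast_nonneg hm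
  have hn' : (1 : ℝ) ≤ n := by exact_mod_cast hn
  refine real_deviation_le (bddMeas_statistic ε (coordMean Q) m)
    (c := m ^ 2 * ε ^ 2 / 32) (by positivity)
    (fun ω hω => ?_) ?_
  · rw [integral_statistic hQ]
    simp only [sub_self, ne_eq, OfNat.ofNat_ne_zero, not_false_eq_true, zero_pow, mul_zero,
      Finset.sum_const_zero, sub_zero]
    refine le_trans ?_ (le_abs_self _)
    refine le_of_mul_le_mul_right ?_ (pow_pos hε 2)
    rw [Set.mem_ofPred_eq] at hω
    linarith
  · rw [variance_statistic hQ]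
    simp only [sub_self, ne_eq, OfNat.ofNat_ne_zero, not_false_eq_true, zero_pow, mul_zero,
      add_zero]
    have h1 : ∑ i, (coordMean Q i * (1 - coordMean Q i) + ε ^ 2 / (4 * n))⁻¹ ^ 2 *
        (coordMean Q i * (1 - coordMean Q i)) ^ 2 ≤ ∑ _i : Fin n, (1 : ℝ) := by
      refine Finset.sum_le_sum fun i _ => ?_
      have hu : 0 ≤ coordMean Q i * (1 - coordMean Q i) :=
        mul_nonneg (coordMean_nonneg Q i) (by linarith [coordMean_le_one Q i])
      have hγ : 0 < ε ^ 2 / (4 * n) := by positivity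
      rw [← mul_pow]
      refine pow_le_one₀ (mul_nonneg (inv_nonneg.2 (by linarith)) hu) ?_
      rw [inv_mul_le_iff₀ (by linarith)]
      linarith
    simp only [Finset.sum_const, Finset.card_univ, Fintype.card_fin, nsmul_eq_mul, mul_one] at h1
    refine (mul_le_mul_of_nonneg_left h1
      (div_nonneg (mul_nonneg (by linarith) (by linarith)) zero_le_two)).trans ?_
    have h2 : (m : ℝ) * (m - 1) / 2 * n ≤ m ^ 2 / 2 * n := by nlinarith
    refine h2.trans ?_
    have h3 : (m : ℝ) ^ 2 * (1048576 * n) ≤ m ^ 2 * (m * ε ^ 2) ^ 2 :=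
      mul_le_mul_of_nonneg_left hm (by positivity)
    nlinarith

theorem real_accept_le {n : ℕ} {ε : ℝ} {m : ℕ} {P Q : Measure (Cube n)} [IsProbabilityMeasure P]
    [IsProbabilityMeasure Q] (hP : IsProductDistribution P) (hQ : IsProductDistribution Q)
    (hn : 1 ≤ n) (hε : 0 < ε) (hε1 : ε ≤ 1) (hm : 1048576 * n ≤ (m * ε ^ 2) ^ 2)
    (hPQ : ε ≤ tvDist P Q) :
    (sourceLaw P).real {ω | statistic ε (coordMean Q) ω m * ε ^ 2 < (m * ε ^ 2) ^ 2 / 32} ≤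
      1 / 3 := by
  have hm1 : (1024 : ℝ) ≤ m := card_bounds hn hε1 hε m.cast_nonneg hm
  have hn' : (1 : ℝ) ≤ n := by exact_mod_cast hn
  obtain ⟨S, hS⟩ : ∃ S, S = ∑ i, (coordMean Q i * (1 - coordMean Q i) + ε ^ 2 / (4 * n))⁻¹ *
    (coordMean P i - coordMean Q i) ^ 2 := ⟨_, rfl⟩
  -- With `γ = ε² / (4n)` the loss `n γ` is only `ε²/4`.
  have hSε : 3 / 8 * ε ^ 2 ≤ S := by
    have h := sq_tvDist_le hP hQ (γ := ε ^ 2 / (4 * n)) (by positivity)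
    simp only [div_eq_inv_mul _ (_ + _)] at h
    rw [← hS] at h
    have h1 : (n : ℝ) * (ε ^ 2 / (4 * n)) = ε ^ 2 / 4 := by field_simp
    have h2 := pow_le_pow_left₀ hε.le hPQ 2
    rw [h1] at h
    linarith
  have hS0 : 0 < S := lt_of_lt_of_le (by positivity) hSε
  have hv := variance_bound hn hε (by linarith) (coordMean_nonneg P) (coordMean_le_one P)
    (coordMean_nonneg Q) (coordMean_le_one Q) (fun _ => rfl) hS hSε hm
  have hmm : (m : ℝ) ^ 2 / 4 ≤ m * (m - 1) / 2 := by nlinarith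
  -- The mean is at least `3 m² ε² / 32`, so the threshold `m² ε² / 32` lies below half of it and
  -- acceptance is a deviation by at least half the mean.
  refine real_deviation_le (bddMeas_statistic ε (coordMean Q) m) (c := m * (m - 1) / 2 * S / 2)
    (half_pos (mul_pos (lt_of_lt_of_le (by positivity) hmm) hS0)) (fun ω hω => ?_) ?_
  · rw [integral_statistic hP, ← hS]
    have h1 : statistic ε (coordMean Q) ω m ≤ m ^ 2 * ε ^ 2 / 32 := by
      refine le_of_mul_le_mul_right ?_ (pow_pos hε 2)
      rw [Set.mem_ofPred_eq] at hω
      linarith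
    have h2 : (m : ℝ) ^ 2 / 4 * (3 / 8 * ε ^ 2) ≤ m * (m - 1) / 2 * S :=
      mul_le_mul hmm hSε (by positivity) (le_trans (by positivity) hmm)
    rw [abs_sub_comm]
    refine le_trans ?_ (le_abs_self _)
    nlinarith [sq_nonneg ((m : ℝ) * ε)]
  · rw [variance_statistic hP]
    have hc0 : (0 : ℝ) ≤ m * (m - 1) / 2 := le_trans (by positivity) hmm
    refine (mul_le_mul_of_nonneg_left hv hc0).trans ?_
    have h4 : (m : ℝ) ^ 2 / 4 * (m * (m - 1) / 2 * S ^ 2) ≤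
        m * (m - 1) / 2 * (m * (m - 1) / 2 * S ^ 2) :=
      mul_le_mul_of_nonneg_right hmm (mul_nonneg hc0 (sq_nonneg S))
    linarith

theorem exists_distinguishes_uStatTester (n : ℕ) (ε : ℝ) (hn : 1 ≤ n) (hε : 0 < ε) (hε1 : ε ≤ 1) :
    ∃ m T : ℕ, (m : ℝ) ≤ 50000 * (Real.sqrt n / ε ^ 2) ∧
      (T : ℝ) ≤ 50000 * ((n : ℝ) ^ (3 / 2 : ℝ) / ε ^ 2) ∧
      ∀ (Q : Measure (Cube n)) [IsProbabilityMeasure Q], IsProductDistribution Q →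
        Distinguishes uStatTester ε Q m T := by
  have hn' : (1 : ℝ) ≤ n := by exact_mod_cast hn
  have hs1 : 1 ≤ √(n : ℝ) := Real.one_le_sqrt.2 hn'
  have hε2 : ε ^ 2 ≤ 1 := pow_le_one₀ hε.le hε1
  have hX1 : 1 ≤ √(n : ℝ) / ε ^ 2 := by
    rw [one_le_div (by positivity)]
    linarith
  set X := √(n : ℝ) / ε ^ 2 with hX
  have hXε : X * ε ^ 2 = √(n : ℝ) := div_mul_cancel₀ _ (by positivity)
  have hsq : √(n : ℝ) ^ 2 = n := Real.sq_sqrt (by positivity)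
  -- The loop stops at the first sample count `r + 1` with `r + 1 ≥ 1024 X`, as `1024² = 1048576`.
  obtain ⟨r, hr⟩ : ∃ r, ⌈1024 * X⌉₊ = r + 1 :=
    Nat.exists_eq_succ_of_ne_zero (Nat.ceil_pos.2 (by positivity)).ne'
  have hr1 : 1024 * X ≤ (r + 1 : ℕ) := hr ▸ Nat.le_ceil _
  have hr2 : (r : ℝ) < 1024 * X := by
    have : r < ⌈1024 * X⌉₊ := by omega
    exact Nat.lt_ceil.1 this
  have hlt : ∀ k ≤ r, ((k : ℕ) * ε ^ 2) ^ 2 < 1048576 * n := by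
    intro k hk
    have h1 : (k : ℝ) < 1024 * X := lt_of_le_of_lt (by exact_mod_cast hk) hr2
    have h2 : k * ε ^ 2 < 1024 * √(n : ℝ) := by
      rw [← hXε, ← mul_assoc]
      exact mul_lt_mul_of_pos_right h1 (by positivity)
    have h3 := pow_lt_pow_left₀ h2 (by positivity) two_ne_zero
    rw [mul_pow 1024, hsq] at h3
    linarith
  have hge : 1048576 * n ≤ ((r + 1 : ℕ) * ε ^ 2) ^ 2 := by
    have h2 : 1024 * √(n : ℝ) ≤ (r + 1 : ℕ) * ε ^ 2 := by
      rw [← hXε, ← mul_assoc]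
      exact mul_le_mul_of_nonneg_right hr1 (by positivity)
    have h3 := pow_le_pow_left₀ (by positivity) h2 2
    rw [mul_pow 1024, hsq] at h3
    linarith
  refine ⟨r + 1, 17 + 18 * n + (6 + 15 * n) * r, ?_, ?_, fun Q _ hQ => ⟨fun ω => ?_, ?_⟩⟩
  · push_cast
    linarith
  · have h32 : (n : ℝ) ^ (3 / 2 : ℝ) / ε ^ 2 = n * X := by
      have : (n : ℝ) ^ (3 / 2 : ℝ) = n * √(n : ℝ) := by
        rw [Real.sqrt_eq_rpow, ← Real.rpow_one_add' (by positivity) (by norm_num)]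
        norm_num
      rw [this, hX, mul_div_assoc]
    rw [h32]
    push_cast
    have h1 : (n : ℝ) ≤ n * X := by nlinarith
    have h2 : (n : ℝ) * r ≤ n * (1024 * X) := mul_le_mul_of_nonneg_left hr2.le (by positivity)
    have h3 : (r : ℝ) ≤ n * r := by nlinarith [(Nat.cast_nonneg r : (0 : ℝ) ≤ r)]
    nlinarith
  · obtain ⟨h1, h2⟩ := run_uStatTester ε (coordMean Q) ω hn hlt hge
    rw [h1, h2]
    simp
  · intro P _ hP
    have hrun (ω : Source n) := (run_uStatTester ε (coordMean Q) ω hn hlt hge).2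
    constructor
    · rintro rfl
      convert real_reject_le hP hn hε hε1 hge using 3
      ext ω
      simp [hrun]
    · intro hPQ
      convert real_accept_le hP hQ hn hε hε1 hge hPQ using 3
      ext ω
      simp [hrun]

end Tester

/-! ### Randomly biased product distributions -/

section LowerBound

/-- A bit as a sign. -/
def sign (b : Bool) : ℝ := if b then 1 else -1

/-- The law of a bit with mean `p`. -/
noncomputable def bitLaw (p : ℝ) : Measure Bool :=
  ENNReal.ofReal p • Measure.dirac true + ENNReal.ofReal (1 - p) • Measure.dirac false

theorem isProbabilityMeasure_bitLaw {p : ℝ} (h0 : 0 ≤ p) (h1 : p ≤ 1) :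
    IsProbabilityMeasure (bitLaw p) := by
  refine ⟨?_⟩
  simp only [bitLaw, Measure.coe_add, Measure.coe_smul, Pi.add_apply, Pi.smul_apply,
    measure_univ, smul_eq_mul, mul_one]
  rw [← ENNReal.ofReal_add h0 (by linarith)]
  simp

theorem bitLaw_real_true {p : ℝ} (h0 : 0 ≤ p) : (bitLaw p).real {true} = p := by
  simp [bitLaw, Measure.real, h0]

/-- The product distribution whose coordinate `i` has bias `η` in the direction `s i`. -/
noncomputable def biased {n : ℕ} (η : ℝ) (s : Cube n) : Measure (Cube n) :=
  Measure.pi fun i => bitLaw ((1 + η * sign (s i)) / 2)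

variable {n : ℕ} {η : ℝ}

theorem bias_mem (h0 : 0 ≤ η) (h1 : η ≤ 1) (b : Bool) :
    0 ≤ (1 + η * sign b) / 2 ∧ (1 + η * sign b) / 2 ≤ 1 := by
  cases b <;> simp only [sign, if_true, Bool.false_eq_true, if_false] <;> constructor <;> linarith

theorem isProbabilityMeasure_bias (h0 : 0 ≤ η) (h1 : η ≤ 1) (b : Bool) :
    IsProbabilityMeasure (bitLaw ((1 + η * sign b) / 2)) :=
  isProbabilityMeasure_bitLaw (bias_mem h0 h1 b).1 (bias_mem h0 h1 b).2

theorem isProbabilityMeasure_biased (h0 : 0 ≤ η) (h1 : η ≤ 1) (s : Cube n) :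
    IsProbabilityMeasure (biased η s) := by
  have := fun i => isProbabilityMeasure_bias h0 h1 (s i)
  unfold biased
  infer_instance

theorem isProductDistribution_biased (h0 : 0 ≤ η) (h1 : η ≤ 1) (s : Cube n) :
    IsProductDistribution (biased η s) :=
  ⟨_, fun i => isProbabilityMeasure_bias h0 h1 (s i), rfl⟩

theorem biased_real_singleton (h0 : 0 ≤ η) (h1 : η ≤ 1) (s x : Cube n) :
    (biased η s).real {x} = ∏ i, (1 + η * sign (s i) * sign (x i)) / 2 := by
  have := fun i => isProbabilityMeasure_bias h0 h1 (s i)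
  rw [biased, real_pi_singleton]
  refine Finset.prod_congr rfl fun i _ => ?_
  rw [bitLaw_real_true (bias_mem h0 h1 (s i)).1]
  cases x i <;> simp only [bernoulliMass, sign, if_true, Bool.false_eq_true, if_false] <;> ring

theorem prod_sum_bool {R : Type*} [CommRing R] (f : Fin n → Bool → R) :
    ∑ x : Cube n, ∏ i, f i (x i) = ∏ i, (f i true + f i false) := by
  simp only [← Fintype.sum_bool]
  rw [Finset.prod_univ_sum, Fintype.piFinset_univ]

/-- The one-bit coefficient with the uniform bit is at most `1 - η²/8`, and coefficients multiply.
This reaches distances close to 1. -/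
theorem biased_affinity (h0 : 0 ≤ η) (h1 : η ≤ 1) (s : Cube n) :
    1 - (1 - η ^ 2 / 8) ^ n ≤ tvDist (biased η s) (biased 0 s) := by
  have i1 := isProbabilityMeasure_biased h0 h1 s
  have i2 := isProbabilityMeasure_biased le_rfl zero_le_one s
  have h := one_sub_affinity_le (a := fun x => (biased η s).real {x})
    (b := fun x => (biased 0 s).real {x}) (fun _ => measureReal_nonneg)
    (fun _ => measureReal_nonneg) (sum_real_singleton _) (sum_real_singleton _)
  refine le_trans ?_ h
  simp only [biased_real_singleton h0 h1, biased_real_singleton le_rfl zero_le_one]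
  have hnn (η : ℝ) (h0 : 0 ≤ η) (h1 : η ≤ 1) (i : Fin n) (b : Bool) :
      0 ≤ (1 + η * sign (s i) * sign b) / 2 := by
    cases s i <;> cases b <;> simp [sign] <;> linarith
  rw [affinity_prod (f := fun i b => (1 + η * sign (s i) * sign b) / 2)
    (g := fun i b => (1 + 0 * sign (s i) * sign b) / 2) (hnn η h0 h1)
    (hnn 0 le_rfl zero_le_one)]
  have hle (i : Fin n) : affinity (fun b => (1 + η * sign (s i) * sign b) / 2)
      (fun b => (1 + 0 * sign (s i) * sign b) / 2) ≤ 1 - η ^ 2 / 8 := by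
    have key : √((1 + η) / 2 * (1 / 2)) + √((1 - η) / 2 * (1 / 2)) ≤ 1 - η ^ 2 / 8 := by
      refine abs_le_of_sq_le_sq' ?_ (by nlinarith) |>.2
      have e1 := Real.sq_sqrt (show 0 ≤ (1 + η) / 2 * (1 / 2) by linarith)
      have e2 := Real.sq_sqrt (show 0 ≤ (1 - η) / 2 * (1 / 2) by linarith)
      have e3 : √((1 + η) / 2 * (1 / 2)) * √((1 - η) / 2 * (1 / 2)) ≤ (1 - η ^ 2 / 2) / 4 := by
        rw [← Real.sqrt_mul (by linarith)]
        refine Real.sqrt_le_iff.2 ⟨by nlinarith, ?_⟩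
        nlinarith [sq_nonneg (η ^ 2)]
      nlinarith [sq_nonneg (η ^ 2)]
    rw [affinity, Fintype.sum_bool]
    cases s i
    · simp only [sign, if_true, Bool.false_eq_true, if_false]
      refine le_of_eq_of_le ?_ key
      rw [add_comm]
      congr 2 <;> ring
    · simp only [sign, if_true, Bool.false_eq_true, if_false]
      refine le_of_eq_of_le ?_ key
      congr 2 <;> ring
  have hprod := Finset.prod_le_prod (s := Finset.univ)
    (fun i _ => Finset.sum_nonneg fun _ _ => Real.sqrt_nonneg _) fun i _ => hle i
  simp only [Finset.prod_const, Finset.card_univ, Fintype.card_fin] at hprod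
  exact sub_le_sub_left hprod 1

/-- Majorization: the expansion on the left has nonnegative coefficients. -/
theorem norm_one_add_pow_sub_le (z : ℂ) (k : ℕ) :
    ‖(1 + z) ^ k - 1 - k * z‖ ≤ (1 + ‖z‖) ^ k - 1 - k * ‖z‖ := by
  induction k with
  | zero => simp
  | succ k ih =>
    have e : (1 + z) ^ (k + 1) - 1 - ((k + 1 : ℕ) : ℂ) * z =
        (1 + z) * ((1 + z) ^ k - 1 - k * z) + k * z ^ 2 := by
      push_cast
      ring
    have h1 : ‖1 + z‖ ≤ 1 + ‖z‖ := (norm_add_le _ _).trans (by simp)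
    rw [e]
    refine (norm_add_le _ _).trans ?_
    rw [norm_mul, norm_mul, norm_pow, Complex.norm_natCast]
    have h2 := mul_le_mul h1 ih (norm_nonneg _) (by positivity)
    refine (add_le_add_left h2 _).trans (le_of_eq ?_)
    push_cast
    ring

theorem le_im_one_add_pow {u : ℝ} (hu : 0 ≤ u) (k : ℕ) (hk : k * u ≤ 1) :
    k * u - (k * u) ^ 2 ≤ ((1 + u * Complex.I) ^ k).im := by
  have h := norm_one_add_pow_sub_le (u * Complex.I) k
  have hnorm : ‖(u : ℂ) * Complex.I‖ = u := by simp [abs_of_nonneg hu]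
  rw [hnorm] at h
  have h1 : (1 + u) ^ k ≤ Real.exp (k * u) := by
    rw [Real.exp_nat_mul]
    exact pow_le_pow_left₀ (by linarith) (by linarith [Real.add_one_le_exp u]) k
  have hku : 0 ≤ k * u := by positivity
  have h2 := Real.abs_exp_sub_one_sub_id_le (x := k * u) (by rwa [abs_of_nonneg hku])
  have h3 := (Complex.abs_im_le_norm _).trans h
  have h4 : ((1 + u * Complex.I) ^ k - 1 - k * (u * Complex.I)).im =
      ((1 + u * Complex.I) ^ k).im - k * u := by
    simp
  rw [h4] at h3
  have h5 := (abs_le.1 h3).1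
  have h6 := (abs_le.1 h2).2
  linarith

/-- Linear in `√n η`, where the affinity bound is only quadratic. The distance is tested against a
bounded complex function whose mean under `biased η s` is an explicit power. -/
theorem biased_tvDist_ge (hn : 1 ≤ n) (h0 : 0 ≤ η) (h1 : η ≤ 1) (hη : √n * η ≤ 1) (s : Cube n) :
    (√n * η - (√n * η) ^ 2) / 4 ≤ tvDist (biased η s) (biased 0 s) := by
  have hn' : (1 : ℝ) ≤ n := by exact_mod_cast hn
  have hs0 : 0 < √(n : ℝ) := Real.sqrt_pos.2 (by linarith)
  have hsq : √(n : ℝ) ^ 2 = n := Real.sq_sqrt (by positivity)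
  set t := 1 / √(n : ℝ) with ht
  have ht0 : 0 < t := by positivity
  have ht2 : n * t ^ 2 = 1 := by
    rw [ht, div_pow, hsq, one_pow]
    field_simp
  -- With `t = 1/√n` the norm of `F` is at most `√e < 2`, while the imaginary part of its mean `(1 +
  -- i t η)^n` is about `√n η`.
  let F : Cube n → ℂ := fun x => ∏ i, (1 + (t * (sign (s i) * sign (x i)) : ℝ) * Complex.I)
  have hF (x) : ‖F x‖ ≤ 2 := by
    refine abs_le_of_sq_le_sq' ?_ zero_le_two |>.2
    simp only [F, norm_prod, ← Finset.prod_pow]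
    have e (i : Fin n) :
        ‖1 + (t * (sign (s i) * sign (x i)) : ℝ) * Complex.I‖ ^ 2 = 1 + t ^ 2 := by
      rw [← Complex.normSq_eq_norm_sq, ← Complex.ofReal_one, Complex.normSq_add_mul_I]
      cases s i <;> cases x i <;> simp [sign]
    simp only [e, Finset.prod_const, Finset.card_univ, Fintype.card_fin]
    have : (1 + t ^ 2) ^ n ≤ Real.exp (n * t ^ 2) := by
      rw [Real.exp_nat_mul]
      exact pow_le_pow_left₀ (by positivity) (by linarith [Real.add_one_le_exp (t ^ 2)]) n
    rw [ht2] at this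
    linarith [Real.exp_one_lt_d9]
  have hmean (η : ℝ) (h0 : 0 ≤ η) (h1 : η ≤ 1) :
      ∑ x, ((biased η s).real {x} : ℂ) * F x = (1 + (t * η : ℝ) * Complex.I) ^ n := by
    simp only [biased_real_singleton h0 h1, F, Complex.ofReal_prod, ← Finset.prod_mul_distrib]
    rw [prod_sum_bool fun i b => (((1 + η * sign (s i) * sign b) / 2 : ℝ) : ℂ) *
      (1 + (t * (sign (s i) * sign b) : ℝ) * Complex.I)]
    have e (i : Fin n) : (((1 + η * sign (s i) * sign true) / 2 : ℝ) : ℂ) *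
        (1 + (t * (sign (s i) * sign true) : ℝ) * Complex.I) +
        (((1 + η * sign (s i) * sign false) / 2 : ℝ) : ℂ) *
        (1 + (t * (sign (s i) * sign false) : ℝ) * Complex.I) =
        1 + (t * η : ℝ) * Complex.I := by
      cases s i <;> simp only [sign, if_true, Bool.false_eq_true, if_false] <;> push_cast <;> ring
    simp only [e, Finset.prod_const, Finset.card_univ, Fintype.card_fin]
  have hdiff : ‖(1 + (t * η : ℝ) * Complex.I) ^ n - 1‖ ≤ 4 * tvDist (biased η s) (biased 0 s) := by
    have e : (1 + (t * η : ℝ) * Complex.I) ^ n - 1 =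
        ∑ x, (((biased η s).real {x} - (biased 0 s).real {x} : ℝ) : ℂ) * F x := by
      have := hmean 0 le_rfl zero_le_one
      simp only [mul_zero, Complex.ofReal_zero, zero_mul, add_zero, one_pow] at this
      simp only [Complex.ofReal_sub, sub_mul, Finset.sum_sub_distrib]
      rw [hmean η h0 h1, this]
    rw [e, tvDist]
    refine (norm_sum_le _ _).trans ?_
    rw [← mul_assoc, Finset.mul_sum]
    refine Finset.sum_le_sum fun x _ => ?_
    rw [norm_mul, Complex.norm_real, Real.norm_eq_abs]
    have := mul_le_mul_of_nonneg_left (hF x)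
      (abs_nonneg ((biased η s).real {x} - (biased 0 s).real {x}))
    linarith
  have hnt : n * (t * η) = √n * η := by
    rw [ht, ← mul_assoc, mul_one_div]
    nth_rewrite 1 [← hsq]
    rw [pow_two, mul_div_assoc, div_self hs0.ne', mul_one]
  have him := le_im_one_add_pow (u := t * η) (by positivity) n (by rwa [hnt])
  rw [hnt] at him
  have h5 := (le_abs_self _).trans
    (Complex.abs_im_le_norm ((1 + (t * η : ℝ) * Complex.I) ^ n - 1))
  rw [Complex.sub_im, Complex.one_im, sub_zero] at h5
  linarith

theorem biased_zero (s s' : Cube n) : biased 0 s = biased 0 s' := by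
  simp [biased]

/-- The density of `biased η s` with respect to the uniform distribution. -/
noncomputable def density (η : ℝ) (s x : Cube n) : ℝ := ∏ i, (1 + η * sign (s i) * sign (x i))

theorem biased_real_eq_density (h0 : 0 ≤ η) (h1 : η ≤ 1) (s x : Cube n) :
    (biased η s).real {x} = (1 / 2) ^ n * density η s x := by
  rw [biased_real_singleton h0 h1, density]
  rw [Finset.prod_div_distrib, div_eq_inv_mul]
  simp

theorem sum_density_mul (s s' : Cube n) :
    (1 / 2 : ℝ) ^ n * ∑ x, density η s x * density η s' x =
      ∏ i, (1 + η ^ 2 * (sign (s i) * sign (s' i))) := by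
  simp only [density, ← Finset.prod_mul_distrib]
  rw [prod_sum_bool fun i b => (1 + η * sign (s i) * sign b) * (1 + η * sign (s' i) * sign b)]
  have : (1 / 2 : ℝ) ^ n = ∏ _i : Fin n, (1 / 2 : ℝ) := by simp
  rw [this, ← Finset.prod_mul_distrib]
  refine Finset.prod_congr rfl fun i _ => ?_
  simp only [sign, if_true, Bool.false_eq_true, if_false]
  ring

theorem integral_pi_biased (h0 : 0 ≤ η) (h1 : η ≤ 1) (s : Cube n) {m : ℕ}
    (F : (Fin m → Cube n) → ℝ) :
    ∫ x, F x ∂(Measure.pi fun _ : Fin m => biased η s) =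
      ∑ x : Fin m → Cube n, ((1 / 2) ^ n) ^ m * (∏ j, density η s (x j)) * F x := by
  have := isProbabilityMeasure_biased h0 h1 s
  rw [integral_fintype .of_finite]
  refine Finset.sum_congr rfl fun x _ => ?_
  have e : (Measure.pi fun _ : Fin m => biased η s).real {x} =
      ∏ j, (biased η s).real {x j} := by
    rw [Measure.real, Measure.pi_singleton, ENNReal.toReal_prod]
    rfl
  rw [e, smul_eq_mul]
  simp only [biased_real_eq_density h0 h1]
  rw [Finset.prod_mul_distrib]
  simp

theorem sum_prod_density (s s' : Cube n) (m : ℕ) :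
    ((1 / 2 : ℝ) ^ n) ^ m *
      ∑ x : Fin m → Cube n, (∏ j, density η s (x j)) * ∏ j, density η s' (x j) =
      ∏ i, (1 + η ^ 2 * (sign (s i) * sign (s' i))) ^ m := by
  simp only [← Finset.prod_mul_distrib]
  rw [← Fintype.sum_pow (fun x => density η s x * density η s' x) m, ← mul_pow, sum_density_mul,
    Finset.prod_pow]

/-- For fixed `s`, the products `sign (s i) * sign (s' i)` are again uniform signs, so the average
does not depend on `s`. -/
theorem sum_prod_sign_pow (s : Cube n) (a : ℝ) (m : ℕ) :
    (1 / 2 : ℝ) ^ n * ∑ s' : Cube n, ∏ i, (1 + a * (sign (s i) * sign (s' i))) ^ m =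
      (((1 + a) ^ m + (1 - a) ^ m) / 2) ^ n := by
  rw [prod_sum_bool fun i b => (1 + a * (sign (s i) * sign b)) ^ m]
  have : (1 / 2 : ℝ) ^ n = ∏ _i : Fin n, (1 / 2 : ℝ) := by simp
  rw [this, ← Finset.prod_mul_distrib]
  have e (i : Fin n) : 1 / 2 * ((1 + a * (sign (s i) * sign true)) ^ m +
      (1 + a * (sign (s i) * sign false)) ^ m) = ((1 + a) ^ m + (1 - a) ^ m) / 2 := by
    cases s i <;> simp only [sign, if_true, Bool.false_eq_true, if_false] <;> ring_nf
  simp only [e, Finset.prod_const, Finset.card_univ, Fintype.card_fin]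

end LowerBound

/-! ### Second-moment method and the sample lower bound -/

section SampleBound

variable {n : ℕ} {η : ℝ}

theorem sum_prod_density_eq_one (h0 : 0 ≤ η) (h1 : η ≤ 1) (s : Cube n) (m : ℕ) :
    ((1 / 2 : ℝ) ^ n) ^ m * ∑ x : Fin m → Cube n, ∏ j, density η s (x j) = 1 := by
  have := isProbabilityMeasure_biased h0 h1 s
  have h := integral_pi_biased h0 h1 s (m := m) fun _ => 1
  simp only [integral_const, probReal_univ, smul_eq_mul, mul_one, ← Finset.mul_sum] at h
  exact h.symm

theorem half_pow_mul_card (n : ℕ) : (1 / 2 : ℝ) ^ n * ∑ _s : Cube n, (1 : ℝ) = 1 := by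
  simp

/-- The square of the mixture is a double average over independent `s`, `s'`; summing over the
samples first leaves their correlations, which factor over coordinates. -/
theorem likelihood_second_moment (η : ℝ) (m : ℕ) :
    ((1 / 2 : ℝ) ^ n) ^ m * ∑ x : Fin m → Cube n,
      ((1 / 2) ^ n * ∑ s : Cube n, ∏ j, density η s (x j)) ^ 2 =
      (((1 + η ^ 2) ^ m + (1 - η ^ 2) ^ m) / 2) ^ n := by
  set V := (((1 + η ^ 2) ^ m + (1 - η ^ 2) ^ m) / 2) ^ n
  set c := ((1 / 2 : ℝ) ^ n) ^ m
  set κ := (1 / 2 : ℝ) ^ n with hκ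
  have hsq (a : Cube n → ℝ) : (κ * ∑ s, a s) ^ 2 = ∑ s, ∑ s', κ * (κ * (a s * a s')) := by
    simp only [← Finset.mul_sum, ← Finset.sum_mul]
    ring
  have hD (s s' : Cube n) : c * ∑ x : Fin m → Cube n,
      (∏ j, density η s (x j)) * ∏ j, density η s' (x j) =
        ∏ i, (1 + η ^ 2 * (sign (s i) * sign (s' i))) ^ m := sum_prod_density s s' m
  calc c * ∑ x : Fin m → Cube n, (κ * ∑ s : Cube n, ∏ j, density η s (x j)) ^ 2
      = ∑ s : Cube n, ∑ s' : Cube n, κ * (κ * (c * ∑ x : Fin m → Cube n,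
          (∏ j, density η s (x j)) * ∏ j, density η s' (x j))) := by
        simp only [hsq]
        rw [Finset.sum_comm, Finset.mul_sum]
        refine Finset.sum_congr rfl fun s _ => ?_
        rw [Finset.sum_comm, Finset.mul_sum]
        refine Finset.sum_congr rfl fun s' _ => ?_
        simp only [Finset.mul_sum]
        refine Finset.sum_congr rfl fun x _ => ?_
        ring
    _ = κ * ∑ s : Cube n, κ * ∑ s' : Cube n,
          ∏ i, (1 + η ^ 2 * (sign (s i) * sign (s' i))) ^ m := by
        simp only [hD, ← Finset.mul_sum]
    _ = κ * ∑ _s : Cube n, V := by simp only [hκ, sum_prod_sign_pow, V]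
    _ = V := by
        have := half_pow_mul_card n
        rw [Finset.sum_const, nsmul_eq_mul, mul_one] at this
        rw [Finset.sum_const, nsmul_eq_mul, ← mul_assoc, hκ, this, one_mul]

/-- The left side is at most `cosh (m a)`. The first-order terms cancel, which gives `(m a)²` in the
exponent and finally the rate `√n`. -/
theorem half_add_pow_le {a : ℝ} (h0 : 0 ≤ a) (h1 : a ≤ 1) (m : ℕ) :
    ((1 + a) ^ m + (1 - a) ^ m) / 2 ≤ Real.exp ((m * a) ^ 2 / 2) := by
  refine le_trans ?_ (Real.cosh_le_exp_half_sq _)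
  rw [Real.cosh_eq, Real.exp_nat_mul, ← mul_neg, Real.exp_nat_mul]
  have e1 := pow_le_pow_left₀ (by linarith) (by linarith [Real.add_one_le_exp a] :
    1 + a ≤ Real.exp a) m
  have e2 := pow_le_pow_left₀ (by linarith) (by linarith [Real.add_one_le_exp (-a)] :
    1 - a ≤ Real.exp (-a)) m
  linarith

/-- The sample complexity of telling the uniform distribution from a mixture of biased ones. -/
theorem le_of_isTester_uniform (h0 : 0 ≤ η) (h1 : η ≤ 1) {ε : ℝ} {m : ℕ} (s₀ : Cube n)
    {φ : (Fin m → Cube n) → unitInterval} (hφ : IsTester ε (biased 0 s₀) φ)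
    (hfar : ∀ s : Cube n, ε ≤ tvDist (biased η s) (biased 0 s)) : 1 / 5 ≤ n * (m * η ^ 2) ^ 2 := by
  set c := ((1 / 2 : ℝ) ^ n) ^ m with hc
  have hc0 : 0 ≤ c := by positivity
  set L : (Fin m → Cube n) → ℝ := fun x => (1 / 2) ^ n * ∑ s : Cube n, ∏ j, density η s (x j)
    with hL
  have hnull : c * ∑ x, (1 - (φ x : ℝ)) ≤ 1 / 3 := by
    have := isProbabilityMeasure_biased le_rfl zero_le_one s₀
    have h := (hφ _ (isProductDistribution_biased le_rfl zero_le_one s₀)).1 rfl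
    rw [integral_pi_biased le_rfl zero_le_one] at h
    rw [hc]
    simpa [density, ← Finset.mul_sum] using h
  have hone : c * ∑ _x : Fin m → Cube n, (1 : ℝ) = 1 := by
    rw [hc]
    simp
  have halt : c * ∑ x, L x * φ x ≤ 1 / 3 := by
    have h (s : Cube n) : c * ∑ x, (∏ j, density η s (x j)) * φ x ≤ 1 / 3 := by
      have := isProbabilityMeasure_biased h0 h1 s
      have h := (hφ _ (isProductDistribution_biased h0 h1 s)).2 (biased_zero s s₀ ▸ hfar s)
      rw [integral_pi_biased h0 h1] at h
      simpa only [mul_assoc, ← Finset.mul_sum] using h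
    have e : c * ∑ x, L x * φ x =
        (1 / 2) ^ n * ∑ s : Cube n, c * ∑ x, (∏ j, density η s (x j)) * φ x := by
      simp only [hL, Finset.mul_sum, Finset.sum_mul]
      rw [Finset.sum_comm]
      refine Finset.sum_congr rfl fun s _ => Finset.sum_congr rfl fun x _ => ?_
      ring
    rw [e]
    have h2 := mul_le_mul_of_nonneg_left (Finset.sum_le_sum fun s (_ : s ∈ Finset.univ) => h s)
      (by positivity : (0 : ℝ) ≤ (1 / 2) ^ n)
    refine h2.trans (le_of_eq ?_)
    have := half_pow_mul_card n
    rw [Finset.sum_const, nsmul_eq_mul, mul_one] at this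
    rw [Finset.sum_const, nsmul_eq_mul, ← mul_assoc, this, one_mul]
  have hLone : c * ∑ x, L x = 1 := by
    have e : c * ∑ x, L x =
        (1 / 2) ^ n * ∑ s : Cube n, c * ∑ x : Fin m → Cube n, ∏ j, density η s (x j) := by
      simp only [hL, Finset.mul_sum]
      rw [Finset.sum_comm]
      refine Finset.sum_congr rfl fun s _ => Finset.sum_congr rfl fun x _ => ?_
      ring
    rw [e]
    simp only [hc, sum_prod_density_eq_one h0 h1]
    exact half_pow_mul_card n
  have hLsq : c * ∑ x, L x ^ 2 ≤ Real.exp (n * ((m * η ^ 2) ^ 2 / 2)) := by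
    rw [hc, hL, likelihood_second_moment, Real.exp_nat_mul]
    have h2 : η ^ 2 ≤ 1 := pow_le_one₀ h0 h1
    refine pow_le_pow_left₀ ?_ (half_add_pow_le (sq_nonneg η) h2 m) n
    exact div_nonneg (add_nonneg (by positivity) (pow_nonneg (by linarith) m)) zero_le_two
  -- Acceptance has probability at least 2/3 under the uniform law and at most 1/3 under the
  -- mixture.
  have hgap : 1 / 3 ≤ c * ∑ x, φ x * (1 - L x) := by
    have e : c * ∑ x, φ x * (1 - L x) =
        c * ∑ _x : Fin m → Cube n, (1 : ℝ) - c * ∑ x, (1 - (φ x : ℝ)) - c * ∑ x, L x * φ x := by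
      rw [← mul_sub, ← mul_sub, ← Finset.sum_sub_distrib, ← Finset.sum_sub_distrib]
      congr 1
      exact Finset.sum_congr rfl fun x _ => by ring
    rw [e, hone]
    linarith
  have hφsq : c * ∑ x, (φ x : ℝ) ^ 2 ≤ 1 := by
    rw [← hone]
    exact mul_le_mul_of_nonneg_left (Finset.sum_le_sum fun x _ =>
      pow_le_one₀ (φ x).2.1 (φ x).2.2) hc0
  have hvar : c * ∑ x, (1 - L x) ^ 2 = c * ∑ x, L x ^ 2 - 1 := by
    have e : c * ∑ x, (1 - L x) ^ 2 =
        c * ∑ _x : Fin m → Cube n, (1 : ℝ) - 2 * (c * ∑ x, L x) + c * ∑ x, L x ^ 2 := by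
      rw [mul_left_comm 2 c, ← mul_sub, ← mul_add, Finset.mul_sum _ _ (2 : ℝ),
        ← Finset.sum_sub_distrib, ← Finset.sum_add_distrib]
      congr 1
      exact Finset.sum_congr rfl fun x _ => by ring
    rw [e, hone, hLone]
    ring
  have hcs : (c * ∑ x, φ x * (1 - L x)) ^ 2 ≤
      (c * ∑ x, (φ x : ℝ) ^ 2) * (c * ∑ x, (1 - L x) ^ 2) := by
    have := mul_le_mul_of_nonneg_left (Finset.sum_mul_sq_le_sq_mul_sq Finset.univ
      (fun x => (φ x : ℝ)) fun x => 1 - L x) (sq_nonneg c)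
    calc _ = c ^ 2 * (∑ x, φ x * (1 - L x)) ^ 2 := by ring
      _ ≤ _ := this
      _ = _ := by ring
  have hv0 : 0 ≤ c * ∑ x, (1 - L x) ^ 2 :=
    mul_nonneg hc0 (Finset.sum_nonneg fun x _ => sq_nonneg _)
  -- By Cauchy–Schwarz `(1/3)²` is at most the variance of `L`.
  have hexp : 10 / 9 ≤ Real.exp (n * ((m * η ^ 2) ^ 2 / 2)) := by nlinarith
  by_contra! hlt
  have h2 := Real.add_one_le_exp (-(n * ((m * η ^ 2) ^ 2 / 2)))
  have h3 : Real.exp (n * ((m * η ^ 2) ^ 2 / 2)) * Real.exp (-(n * ((m * η ^ 2) ^ 2 / 2))) = 1 := by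
    rw [← Real.exp_add, add_neg_cancel, Real.exp_zero]
  nlinarith

/-- No test without samples distinguishes two point masses. -/
theorem pos_of_isTester_point (hn : 1 ≤ n) {ε : ℝ} (hε : ε ≤ 1) {m : ℕ}
    {φ : (Fin m → Cube n) → unitInterval}
    (hφ : IsTester ε (biased 1 (fun _ : Fin n => false)) φ) : 1 ≤ m := by
  by_contra! hm
  obtain rfl : m = 0 := by omega
  have i1 := isProbabilityMeasure_biased zero_le_one le_rfl (fun _ : Fin n => false)
  have i2 := isProbabilityMeasure_biased zero_le_one le_rfl (fun _ : Fin n => true)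
  have h1 := (hφ _ (isProductDistribution_biased zero_le_one le_rfl _)).1 rfl
  have h2 := (hφ _ (isProductDistribution_biased zero_le_one le_rfl fun _ : Fin n => true)).2 (by
    refine hε.trans ?_
    have h := one_sub_affinity_le
      (a := fun x => (biased 1 fun _ : Fin n => true).real {x})
      (b := fun x => (biased 1 fun _ : Fin n => false).real {x}) (fun _ => measureReal_nonneg)
      (fun _ => measureReal_nonneg) (sum_real_singleton _) (sum_real_singleton _)
    refine le_trans ?_ h
    rw [affinity, Finset.sum_eq_zero, sub_zero]
    intro x _
    rw [biased_real_singleton zero_le_one le_rfl, biased_real_singleton zero_le_one le_rfl,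
      ← Finset.prod_mul_distrib, Finset.prod_eq_zero (Finset.mem_univ (⟨0, hn⟩ : Fin n)),
      Real.sqrt_zero]
    cases x ⟨0, hn⟩ <;> simp [sign])
  have e (x : Fin 0 → Cube n) : φ x = φ default := by rw [Subsingleton.elim x default]
  simp only [e, integral_const, probReal_univ, smul_eq_mul, one_mul] at h1 h2
  linarith

theorem sample_lower_bound (ε₀ : ℝ) (hε₀ : ε₀ < 1) :
    ∃ c : ℝ, 0 < c ∧ ∀ (n : ℕ) (ε : ℝ), 1 ≤ n → 0 < ε → ε ≤ ε₀ →
      ∃ (Q : Measure (Cube n)) (_ : IsProbabilityMeasure Q), IsProductDistribution Q ∧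
        ∀ (m : ℕ) (φ : (Fin m → Cube n) → unitInterval),
          IsTester ε Q φ → c * (Real.sqrt n / ε ^ 2) ≤ m := by
  rcases le_or_gt ε₀ 0 with hneg | hpos
  · exact ⟨1, one_pos, fun n ε _ h1 h2 => absurd h1 (by linarith)⟩
  have hd : 0 < 1 - ε₀ := by linarith
  -- Chosen so that `exp (-k/8) = exp (-1/(1 - ε₀)) ≤ 1 - ε₀`, hence bias `η² = k/n` gives distance
  -- at least `ε₀`.
  set k := 8 / (1 - ε₀) with hk
  have hk8 : 8 ≤ k := by
    rw [hk, le_div_iff₀ hd]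
    linarith
  refine ⟨1 / (768 * k), by positivity, fun n ε hn hε hle => ?_⟩
  have hn' : (1 : ℝ) ≤ n := by exact_mod_cast hn
  have hs1 : 1 ≤ √(n : ℝ) := Real.one_le_sqrt.2 hn'
  have hsq : √(n : ℝ) ^ 2 = n := Real.sq_sqrt (by positivity)
  have hconclude (b : ℝ) (hb : 0 < b) (η : ℝ) (hη : η ^ 2 = b / n) (m : ℕ)
      (h : 1 / 5 ≤ n * (m * η ^ 2) ^ 2) : √(n : ℝ) ≤ 3 * b * m := by
    have h2 : n ≤ 5 * (m * b) ^ 2 := by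
      rw [hη] at h
      have e : n * (m * (b / n)) ^ 2 = (m * b) ^ 2 / n := by field_simp
      rw [e, le_div_iff₀ (by positivity)] at h
      linarith
    refine Real.sqrt_le_iff.2 ⟨by positivity, ?_⟩
    nlinarith [sq_nonneg (m * b)]
  rcases le_or_gt ε (1 / 16) with hsmall | hlarge
  -- Here `√n η = 8ε`, and the distance bound `2ε - 16ε²` is at least `ε` exactly because `ε ≤
  -- 1/16`.
  · set η := 8 * ε / √(n : ℝ) with hη
    have hη0 : 0 ≤ η := by positivity
    have hη1 : η ≤ 1 := by
      rw [hη, div_le_one (by positivity)]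
      linarith
    refine ⟨biased 0 fun _ => true, isProbabilityMeasure_biased le_rfl zero_le_one _,
      isProductDistribution_biased le_rfl zero_le_one _, fun m φ hφ => ?_⟩
    have hθ : √(n : ℝ) * η = 8 * ε := by
      rw [hη]
      field_simp
    have h := hconclude (64 * ε ^ 2) (by positivity) η (by rw [hη, div_pow, hsq]; ring) m
      (le_of_isTester_uniform hη0 hη1 _ hφ fun s => by
        refine le_trans ?_ (biased_tvDist_ge hn hη0 hη1 (by rw [hθ]; linarith) s)
        rw [hθ]
        nlinarith)
    rw [← mul_div_assoc, div_le_iff₀ (by positivity), one_div, inv_mul_le_iff₀ (by positivity)]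
    have : (0 : ℝ) ≤ m * ε ^ 2 := by positivity
    nlinarith
  have hε2 : (1 / 16) ^ 2 ≤ ε ^ 2 := pow_le_pow_left₀ (by norm_num) hlarge.le 2
  -- Since `1/ε² ≤ 256`, the constant is `768 = 3 * 256`.
  have hmain (m : ℕ) (h : √(n : ℝ) ≤ 3 * k * m) : 1 / (768 * k) * (√(n : ℝ) / ε ^ 2) ≤ m := by
    rw [← mul_div_assoc, div_le_iff₀ (by positivity), one_div, inv_mul_le_iff₀ (by positivity)]
    have : (0 : ℝ) ≤ k * m := by positivity
    nlinarith
  rcases le_or_gt k n with hkn | hkn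
  · set η := √(k / n) with hη
    have hη2 : η ^ 2 = k / n := Real.sq_sqrt (by positivity)
    have hη0 : 0 ≤ η := Real.sqrt_nonneg _
    have hη1 : η ≤ 1 := by
      rw [hη]
      exact Real.sqrt_le_one.2 (div_le_one_of_le₀ hkn (by positivity))
    refine ⟨biased 0 fun _ => true, isProbabilityMeasure_biased le_rfl zero_le_one _,
      isProductDistribution_biased le_rfl zero_le_one _, fun m φ hφ => hmain m ?_⟩
    refine hconclude k (by positivity) η hη2 m (le_of_isTester_uniform hη0 hη1 _ hφ fun s => ?_)
    refine le_trans ?_ (biased_affinity hη0 hη1 s)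
    have h1 : (1 - η ^ 2 / 8) ^ n ≤ Real.exp (-(k / 8)) := by
      have e : -(k / 8) = n * -(η ^ 2 / 8) := by
        rw [hη2]
        field_simp
      rw [e, Real.exp_nat_mul]
      refine pow_le_pow_left₀ (by nlinarith) ?_ n
      linarith [Real.add_one_le_exp (-(η ^ 2 / 8))]
    have h2 : Real.exp (-(k / 8)) ≤ 1 - ε₀ := by
      have e : k / 8 = (1 - ε₀)⁻¹ := by
        rw [hk]
        field_simp
      rw [Real.exp_neg, e]
      refine inv_le_of_inv_le₀ hd ?_
      linarith [Real.add_one_le_exp (1 - ε₀)⁻¹]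
    linarith
  -- For `n < k` the bias `k/n` is not available. A point mass needs one sample, and `√n ≤ n < k`
  -- makes this enough.
  · refine ⟨biased 1 fun _ => false, isProbabilityMeasure_biased zero_le_one le_rfl _,
      isProductDistribution_biased zero_le_one le_rfl _, fun m φ hφ => hmain m ?_⟩
    have hm : (1 : ℝ) ≤ m := by
      exact_mod_cast pos_of_isTester_point hn (hle.trans hε₀.le) hφ
    have : √(n : ℝ) ≤ n := by nlinarith
    nlinarith

end SampleBound

end ProductTesting

open ProductTesting
theorem theorem11 :
    (∃ (prog : Program) (C : ℝ), ∀ (n : ℕ) (ε : ℝ), 1 ≤ n → 0 < ε → ε ≤ 1 →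
      ∃ m T : ℕ, (m : ℝ) ≤ C * (Real.sqrt n / ε ^ 2) ∧
        (T : ℝ) ≤ C * ((n : ℝ) ^ (3 / 2 : ℝ) / ε ^ 2) ∧
        ∀ (Q : Measure (Cube n)) [IsProbabilityMeasure Q], IsProductDistribution Q →
          Distinguishes prog ε Q m T) ∧
    (∀ ε₀ : ℝ, ε₀ < 1 → ∃ c : ℝ, 0 < c ∧ ∀ (n : ℕ) (ε : ℝ), 1 ≤ n → 0 < ε → ε ≤ ε₀ →
      ∃ (Q : Measure (Cube n)) (_ : IsProbabilityMeasure Q), IsProductDistribution Q ∧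
        ∀ (m : ℕ) (φ : (Fin m → Cube n) → unitInterval),
          IsTester ε Q φ → c * (Real.sqrt n / ε ^ 2) ≤ m) :=
  ⟨⟨uStatTester, 50000, exists_distinguishes_uStatTester⟩, sample_lower_bound⟩
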